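/- **Setting.** There are $n$ bidders and a finite set $G$ of $d=|G|$ goods, each of one of $k$ types, with at least $s$ goods of each type. Bidder $i$ has a gross substitutes valuation $v_i:2^G\to[0,1]$ which does not distinguish goods of the same type: $v_i(S\cup\{g\})=v_i(S\cup\{g'\})$ for $g,g'\notin S$ of the same type, and whenever $0\le p\le p'$ are price vectors, $S$ maximizes $v_i(S)-\sum_{g\in S}p_g$, and $S'\subseteq S$ satisfies $p'_g=p_g$ for all $g\in S'$, some maximizer of the utility at prices $p'$ contains $S'$. Let $0<\alpha,\rho\le 1$, $\varepsilon>0$, $0<\gamma<1$. **Joint differential privacy.** A randomized algorithm $\mathcal M$ which maps vectors $D=(v_1,\dots,v_n)$ of such valuations to vectors of $n$ outputs, one for each bidder, is *$\varepsilon$-jointly differentially private* if for every $i$, all $D,D'$ that agree outside entry $i$, and every set $S$ of vectors of outputs to the other $n-1$ bidders, $\Pr[\mathcal M(D)_{-i}\in S]\le e^{\varepsilon}\Pr[\mathcal M(D')_{-i}\in S]$. **Counters.** $\mathrm{Counter}(\varepsilon_0,N)$ is the binary mechanism: on a stream $\sigma(1),\dots,\sigma(N)\in\{0,1\}$, at each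 time $t$, if $2^j$ is the largest power of two dividing $t$, it forms the noisy partial sum $\hat a_t=\sum_{u=t-2^j+1}^{t}\sigma(u)+\eta_t$ with fresh independent Laplace noise $\eta_t$ of scale $L/\varepsilon_0$, where $L=\lfloor\log_2N\rfloor+1$ is the number of dyadic levels. Its reading at time $t$ is the sum of the noisy partial sums over the disjoint dyadic intervals, given by the binary expansion of $t$, which partition $\{1,\dots,t\}$. **The auction $\mathrm{PAlloc}(\alpha,\rho,\varepsilon)$.** Let $T=\lceil 10/(\alpha\rho)\rceil$, $\varepsilon'=\varepsilon/(2T)$, $E=\frac{2\sqrt2}{\varepsilon'}(\log_2 nT)^{5/2}\ln\frac{4k}{\gamma}+1$, $m=2E+1$. There are independent counters $\mathrm{Counter}(\varepsilon',nT)$, numbered $0,1,\dots,k$. Type $j$ has a price $p_j$ and a current reading $c_j$ of counter $j$, both $0$ at first; bidder $i$ holds a bundle $g(i)$, empty at first. There are $T$ rounds, in each of which the bidders take turns in the order $1,\dots,n$. At her turn: 1. bidder $i$ removes from $g(i)$ each good $g$ with $c_{\mathrm{type}(g)}-d_g\ge s-m$, where $d_g$ is the reading that she saved when she last added $g$; 2.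 let $p_0$ be the sum of the prices of the goods of $g(i)$ at the times she last added them. She picks a maximizer $\omega^*$ of $v_i(\omega)-p(\omega\setminus g(i))-p_0$ over $\omega\supsetneq g(i)$ (if there is such an $\omega$). If $v_i(\omega^*)-p(\omega^*\setminus g(i))-p_0\ge v_i(g(i))-p_0$, she picks $g\in\omega^*\setminus g(i)$, saves the reading $c_{\mathrm{type}(g)}$ as $d_g$, adds $g$ to $g(i)$, and bids $1$ on $\mathrm{type}(g)$ and $0$ on the other types. Otherwise she bids $0$ on all types; 3. each counter $j\ge1$ is fed her bid on type $j$ and $c_j$ is updated; then $p_j$ increases by $\alpha$ if $c_j\ge(p_j/\alpha+1)(s-m)$. The picks in step 2 follow an arbitrary fixed rule that depends only on the bidder, the round, her valuation, her bundle, the prices at which she last added goods, and the current prices. At the end of each round counter $0$ is fed, for each bidder in order, a $1$ if she wants to continue bidding at the current prices and readings (that is, if after the removals of step 1 some $\omega\supsetneq g(i)$ would satisfy the inequality of step 2), and a $0$ otherwise. The auction halts at the end of a round in which counter $0$ increases by less than $\rho d-2E$, and otherwise after $T$ rounds. The output to bidder $i$ consists of the final prices $p$ and her final bundle $g(i)$.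 **Theorem.** For every such rule, $\mathrm{PAlloc}(\alpha,\rho,\varepsilon)$ is a measurable function of the noise, and it is $\varepsilon$-jointly differentially private. -/

import Mathlib

open MeasureTheory

noncomputable section

namespace PrivateAuction

/-! ### Joint differential privacy -/

/-- Two databases are `i`-neighbors if they agree outside the `i`-th entry. -/
def Neighbors {C : Type*} {n : ℕ} (i : Fin n) (D D' : Fin n → C) : Prop :=
  ∀ j, j ≠ i → D j = D' j

/-- A randomized algorithm is given by a random seed with law `μ` and a map `M` which sends a
database and a seed to a vector of outputs, one for each agent. It is `ε`-jointly differentially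
private if the joint law of the outputs to the agents other than `i` is `ε`-indistinguishable
between `i`-neighbors, for each `i`. -/
def IsJointDP {Ω C R : Type*} [MeasurableSpace Ω] {n : ℕ} (μ : Measure Ω)
    (M : (Fin n → C) → Ω → Fin n → R) (ε : ℝ) : Prop :=
  ∀ i : Fin n, ∀ D D' : Fin n → C, Neighbors i D D' →
    ∀ S : Set ({j : Fin n // j ≠ i} → R),
      μ {ω | (fun j : {j : Fin n // j ≠ i} => M D ω j) ∈ S} ≤
        ENNReal.ofReal (Real.exp ε) *
          μ {ω | (fun j : {j : Fin n // j ≠ i} => M D' ω j) ∈ S}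

/-! ### Laplace noise and the binary mechanism -/

/-- The centered Laplace distribution with scale `b` (variance `2 * b ^ 2`). -/
def laplace (b : ℝ) : Measure ℝ :=
  volume.withDensity fun x => ENNReal.ofReal (Real.exp (-|x| / b) / (2 * b))

theorem isProbabilityMeasure_laplace {b : ℝ} (hb : 0 < b) :
    IsProbabilityMeasure (laplace b) := by
  have hint : ∫ x : ℝ, Real.exp (-|x| / b) / (2 * b) = 1 := by
    have h1 := integral_comp_abs (f := fun x : ℝ => Real.exp (-x / b) / (2 * b))
    have h2 : ∫ x in Set.Ioi (0 : ℝ), Real.exp (-x / b) / (2 * b) = 1 / 2 := by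
      have h3 := integral_exp_mul_Ioi (a := -(1 / b)) (by simpa using hb) 0
      have h4 : ∀ x : ℝ, Real.exp (-x / b) / (2 * b) = Real.exp (-(1 / b) * x) / (2 * b) := by
        intro x; congr 2; ring
      simp_rw [h4]
      rw [integral_div, h3]
      simp
      field_simp
    rw [h1, h2]; norm_num
  have hi : Integrable fun x : ℝ => Real.exp (-|x| / b) / (2 * b) := by
    by_contra h
    rw [integral_undef h] at hint
    exact zero_ne_one hint
  constructor
  rw [laplace, withDensity_apply _ MeasurableSet.univ, Measure.restrict_univ,
    ← ofReal_integral_eq_lintegral_ofReal hi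
      (Filter.Eventually.of_forall fun x => by positivity), hint, ENNReal.ofReal_one]

/-- The number of dyadic levels `0, 1, …, ⌊log₂ N⌋` of partial sums which the binary mechanism
maintains on a stream of length `N`. -/
def levels (N : ℕ) : ℕ := Nat.log 2 N + 1

/-- The reading `B(t)` at time `t` of the binary mechanism, run on the stream `σ 1, σ 2, …` with
noise `η 1, η 2, …`. If the binary expansion of `t` has the digit `1` at place `j`, then
`τ = t / 2 ^ j * 2 ^ j` is the last time at which the partial sum of level `j` was recomputed; it is
the sum of the stream over the `2 ^ j` times that end at `τ`, plus the noise `η τ` drawn then. The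
reading is the sum of these noisy partial sums. -/
def binaryMechanism (σ η : ℕ → ℝ) (t : ℕ) : ℝ :=
  ∑ j ∈ (Finset.range (levels t)).filter (fun j => t.testBit j = true),
    ((∑ u ∈ Finset.Ioc (t / 2 ^ j * 2 ^ j - 2 ^ j) (t / 2 ^ j * 2 ^ j), σ u) +
      η (t / 2 ^ j * 2 ^ j))

/-! ### Valuations -/

section Valuations

variable {G : Type*} [DecidableEq G]

/-- The bundles of maximal quasi-linear utility at prices `p`. -/
def demand (v : Finset G → ℝ) (p : G → ℝ) : Set (Finset G) :=
  {S | ∀ S' : Finset G, v S' - ∑ g ∈ S', p g ≤ v S - ∑ g ∈ S, p g}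

/-- The gross substitutes condition. -/
def GrossSubstitutes (v : Finset G → ℝ) : Prop :=
  ∀ p p' : G → ℝ, 0 ≤ p → p ≤ p' → ∀ S ∈ demand v p, ∀ S' ⊆ S,
    (∀ g ∈ S', p' g = p g) → ∃ S'' ∈ demand v p', S' ⊆ S''

/-- Gross substitutes valuations `2^G → [0, 1]` which do not distinguish goods of the same type. -/
structure Valuation (G : Type*) [DecidableEq G] {k : ℕ} (type : G → Fin k) where
  /-- the value of a bundle -/
  val : Finset G → ℝ
  nonneg : ∀ S, 0 ≤ val S
  le_one : ∀ S, val S ≤ 1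
  grossSubstitutes : GrossSubstitutes val
  identical : ∀ g g' : G, type g = type g' → ∀ S : Finset G, g ∉ S → g' ∉ S →
    val (insert g S) = val (insert g' S)

end Valuations

/-! ### The auction -/

/-- The public data of the auction: the parameters, the supply and the types of the goods, for
`n` bidders and `k` types of goods. -/
structure Auction (G : Type*) (n k : ℕ) where
  /-- price increment -/
  α : ℝ
  /-- fraction used in the halting condition -/
  ρ : ℝ
  /-- privacy parameter -/
  ε : ℝ
  /-- failure probability -/
  γ : ℝ
  /-- (minimum) supply of each type of good -/
  s : ℕ
  /-- the type of a good -/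
  type : G → Fin k

/-- The state of the auction. The price of type `j` is `α * ticks j`. -/
structure State (G : Type*) (n k : ℕ) where
  /-- the bundle `g(i)` that bidder `i` holds -/
  held : Fin n → Finset G
  /-- `saved i g` is the count that bidder `i` saved when she last added `g` to her bundle -/
  saved : Fin n → G → ℝ
  /-- `paid i g` is the price, in units of `α`, of `g` when bidder `i` last added it -/
  paid : Fin n → G → ℕ
  /-- the current price of each type, in units of `α` -/
  ticks : Fin k → ℕ
  /-- the current readings of the counters of bids on the types -/
  count : Fin k → ℝ
  /-- the streams fed to the counters of bids so far -/
  bids : Fin k → ℕ → ℝ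
  /-- the stream fed to the counter of unsatisfied bidders so far -/
  reports : ℕ → ℝ
  /-- the reading of the counter of unsatisfied bidders after the last round -/
  unsatisfied : ℝ
  /-- whether the auction has halted -/
  halted : Bool

/-- How a bidder picks, in some round, a bundle and a good: as a function of the bidder, her
valuation, the round, the bundle that she holds, the prices that she paid, and the current
prices. -/
abbrev Choice (G : Type*) (n k : ℕ) : Type _ :=
  Fin n → (Finset G → ℝ) → ℕ → Finset G → (G → ℕ) → (Fin k → ℕ) → Finset G × G

namespace Auction

variable {G : Type*} [Fintype G] [DecidableEq G] {n k : ℕ} (P : Auction G n k)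

/-- The number `T` of rounds. -/
def rounds : ℕ := ⌈10 / (P.α * P.ρ)⌉₊

/-- The length `n T` of the streams. -/
def horizon : ℕ := n * P.rounds

/-- The privacy parameter `ε'` of each counter. -/
def counterEps : ℝ := P.ε / (2 * P.rounds)

/-- The error bound `E` of the counters. -/
def errorBound : ℝ :=
  2 * Real.sqrt 2 / P.counterEps * Real.logb 2 P.horizon ^ (5 / 2 : ℝ) *
    Real.log (4 * k / P.γ) + 1

/-- The supply `s - m` with which the auction is run, where `m = 2 E + 1` is held in reserve. -/
def effectiveSupply : ℝ := P.s - (2 * P.errorBound + 1)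

/-- The seeds: one noise for each counter (`none` is the counter of unsatisfied bidders, `some j`
the counter of bids on type `j`) and each time. -/
abbrev Seed : Type := Option (Fin k) × Fin P.horizon → ℝ

/-- The law of the seed: independent Laplace noises. The scale is that of the binary mechanism
with privacy parameter `ε'` on a stream of length `n T`. -/
def seedLaw : Measure P.Seed :=
  Measure.pi fun _ => laplace (levels P.horizon / P.counterEps)

/-- The noise of a counter at the times `1, …, n T`. -/
def noise (ω : P.Seed) (c : Option (Fin k)) (t : ℕ) : ℝ :=
  if h : t - 1 < P.horizon then ω (c, ⟨t - 1, h⟩) else 0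

/-- The original cost `p₀` of a bundle. -/
def cost (paid : G → ℕ) (held : Finset G) : ℝ := ∑ g ∈ held, P.α * paid g

/-- The utility of `W` at the effective prices of a bidder who holds `held`: goods in `held` at
their original cost, the others at their current prices. -/
def effectiveUtility (v : Finset G → ℝ) (held : Finset G) (paid : G → ℕ) (ticks : Fin k → ℕ)
    (W : Finset G) : ℝ :=
  v W - ∑ g ∈ W \ held, P.α * ticks (P.type g) - P.cost paid held

/-- The choice rule picks a utility-maximizing bundle among those which properly contain the bundle
held, and a good in it which is not held. -/
def IsChoiceRule (choose : Choice G n k) : Prop :=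
  ∀ i v r held paid ticks, held ⊂ Finset.univ →
    let q := choose i v r held paid ticks
    held ⊂ q.1 ∧ q.2 ∈ q.1 \ held ∧
      ∀ W, held ⊂ W → P.effectiveUtility v held paid ticks W ≤
        P.effectiveUtility v held paid ticks q.1

/-- The goods in the bundle of bidder `i` for which she has not been outbid. -/
def kept (st : State G n k) (i : Fin n) : Finset G :=
  (st.held i).filter fun g => st.count (P.type g) - st.saved i g < P.effectiveSupply

/-- Bidder `i` would bid in the current state: her utility would not decrease by extending her
bundle. -/
def Wants (v : Finset G → ℝ) (st : State G n k) (i : Fin n) : Prop :=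
  ∃ W, P.kept st i ⊂ W ∧
    v (P.kept st i) - P.cost (st.paid i) (P.kept st i) ≤
      P.effectiveUtility v (P.kept st i) (st.paid i) st.ticks W

/-- At time `t`, feed the bid vector `b` to the counters of bids, update their readings, and
increase the price of each type whose reading has reached the next multiple of the supply. -/
def feedBids (ω : P.Seed) (t : ℕ) (b : Fin k → ℝ) (st : State G n k) : State G n k :=
  let bids : Fin k → ℕ → ℝ := fun j => Function.update (st.bids j) t (b j)
  let count : Fin k → ℝ := fun j => binaryMechanism (bids j) (P.noise ω (some j)) t
  { st with
    bids := bids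
    count := count
    ticks := fun j =>
      if (st.ticks j + 1) * P.effectiveSupply ≤ count j then st.ticks j + 1 else st.ticks j }

open Classical in
/-- The turn of bidder `i` in round `r` (rounds are numbered from `0`), at time `t`. -/
def turn (choose : Choice G n k) (v : Finset G → ℝ) (ω : P.Seed) (r t : ℕ) (i : Fin n)
    (st : State G n k) : State G n k :=
  let held := P.kept st i
  let q := choose i v r held (st.paid i) st.ticks
  if held ⊂ Finset.univ ∧
      v held - P.cost (st.paid i) held ≤
        P.effectiveUtility v held (st.paid i) st.ticks q.1 then
    P.feedBids ω t (Pi.single (P.type q.2) 1)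
      { st with
        held := Function.update st.held i (insert q.2 held)
        saved := Function.update st.saved i
          (Function.update (st.saved i) q.2 (st.count (P.type q.2)))
        paid := Function.update st.paid i
          (Function.update (st.paid i) q.2 (st.ticks (P.type q.2))) }
  else
    P.feedBids ω t 0 { st with held := Function.update st.held i held }

/-- All bidders take their turns in round `r`, at the times `r n + 1, …, r n + n`. -/
def propose (choose : Choice G n k) (v : Fin n → Finset G → ℝ) (ω : P.Seed) (r : ℕ)
    (st : State G n k) : State G n k :=
  (List.finRange n).foldl (fun st i => P.turn choose (v i) ω r (r * n + i + 1) i st) st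

open Classical in
/-- All bidders report, at the times `r n + 1, …, r n + n` of the counter of unsatisfied bidders,
whether they want to continue bidding; the auction halts if that counter increases by less than
`ρ d - 2 E`, where `d` is the number of goods. -/
def countUnsatisfied (v : Fin n → Finset G → ℝ) (ω : P.Seed) (r : ℕ)
    (st : State G n k) : State G n k :=
  let reports : ℕ → ℝ := (List.finRange n).foldl
    (fun σ (i : Fin n) => Function.update σ (r * n + i + 1) (if P.Wants (v i) st i then 1 else 0)) st.reports
  let reading : ℝ := binaryMechanism reports (P.noise ω none) (r * n + n)
  { st with
    reports := reports
    unsatisfied := reading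
    halted := decide
      (reading - st.unsatisfied < P.ρ * Fintype.card G - 2 * P.errorBound) }

/-- The state after the first `r` rounds. -/
def run (choose : Choice G n k) (v : Fin n → Finset G → ℝ) (ω : P.Seed) : ℕ → State G n k
  | 0 =>
    { held := fun _ => ∅
      saved := fun _ _ => 0
      paid := fun _ _ => 0
      ticks := fun _ => 0
      count := fun _ => 0
      bids := fun _ _ => 0
      reports := fun _ => 0
      unsatisfied := 0
      halted := false }
  | r + 1 =>
    let st := run choose v ω r
    if st.halted then st else P.countUnsatisfied v ω r (P.propose choose v ω r st)

/-- The private auction: each bidder receives the final prices of the `k` types and her bundle. -/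
def palloc (choose : Choice G n k) (D : Fin n → Valuation G P.type) (ω : P.Seed) :
    Fin n → (Fin k → ℝ) × Finset G :=
  let st := P.run choose (fun i => (D i).val) ω P.rounds
  fun i => (fun j => P.α * st.ticks j, st.held i)

end Auction

end PrivateAuction

end

open MeasureTheory

noncomputable section

namespace PrivateAuction

namespace DyadicCount

/-! ### Counting the dyadic intervals that contain the times of a bidder -/

variable {n i T A J a r j : ℕ}

/-! Change variables from the noises `ω` to the noisy partial sums `y` (the nodes of the binary
mechanisms). Once `y` is fixed, every reading is fixed, whatever the streams are. So for two
databases that differ only in entry `i`, the runs driven by `y` agree on the prices and on all data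
of the other bidders, and their streams differ only at the times of bidder `i` (`agreeOff_runWith`).
For each database the passage from `ω` to `y`, which adds the partial sums of the streams of the
run, can be undone, since running the auction on `y` recovers these streams
(`runWith_nodeReader_add_shift`, `runWith_noisyReader_sub_shift`). The shifts are integral, so the
passage is a translation on each of countably many pieces, and comparing the two translations that
lead to the same `y` costs a factor `exp(‖a y - a' y‖₁ / b)` (`measure_le_of_shift`).

The scale is `b = L / ε' = 2 T L / ε`, so the shifts may differ by at most `2 T L` in `ℓ¹`. A
changed bid vector moves by up to `2` and a time may lie in `L` nodes, so a crude bound for the bid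
counters already uses up the budget and leaves nothing for the counter of reports. Two savings help.
The time `w + 1` lies in a node of level `j` only if `w` has the binary digit `0` at place `j`, so
each digit `1` saves `2`. The counter of reports is read only at the ends of rounds, so only the
nodes occurring there need a shift; those containing `w + 1` correspond to places where `w` splits
from the end of a round. It remains to show that, over the times `w = r n + i`, there are at most
twice as many splits as digits `1` (`sum_card_splits_le`); this is where `T ≥ 10` enters.

For this count let `A = ⌊log₂ n⌋`. At places from `A` on, the two halves of a complete dyadic
interval contain almost equally many of the equally spaced times. A time in the left half
contributes at most one split, a time in the right half a digit `1` that counts twice; `surplus`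
records the resulting gain recursively. The incomplete interval at the end loses at most the number
of its times, and the total excess of splits is at most `-1`. The places below `A`, with some splits
at `A`, contribute at most `+1`.

Measurability holds because all decisions depend on countably valued data. -/

theorem two_mul_add_div_le (hn : 0 < n) (p h : ℕ) :
    2 * ((p + h) / n) ≤ p / n + (p + 2 * h) / n + 1 := by
  have h1 := Nat.div_mul_le_self (p + h) n
  have h2 := Nat.lt_mul_div_succ p hn
  have h3 := Nat.lt_mul_div_succ (p + 2 * h) hn
  by_contra! h4
  nlinarith [Nat.mul_le_mul_right n (Nat.succ_le_of_lt h4)]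

theorem div_add_div_le (hn : 0 < n) (p h : ℕ) :
    p / n + (p + 2 * h) / n ≤ 2 * ((p + h) / n) + 1 := by
  have h1 := Nat.lt_mul_div_succ (p + h) hn
  have h2 := Nat.div_mul_le_self p n
  have h3 := Nat.div_mul_le_self (p + 2 * h) n
  by_contra! h4
  nlinarith [Nat.mul_le_mul_right n (Nat.succ_le_of_lt h4)]

/-- The rounds `r < T` in which the time `r * n + i` lies in the `a`-th dyadic interval of length
`2 ^ J`. -/
def cell (n i T J a : ℕ) : Finset ℕ :=
  (Finset.range T).filter fun r => (r * n + i) / 2 ^ J = a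

/-- The number of `r` with `r * n + i < z`. -/
def numBelow (n i z : ℕ) : ℕ := (z + (n - 1 - i)) / n

theorem lt_numBelow_iff (hi : i < n) {z : ℕ} : r < numBelow n i z ↔ r * n + i < z := by
  unfold numBelow
  rw [← Nat.succ_le_iff, Nat.le_div_iff_mul_le (by omega), Nat.succ_mul]
  omega

theorem div_two_pow_eq_iff {w : ℕ} : w / 2 ^ J = a ↔ a * 2 ^ J ≤ w ∧ w < (a + 1) * 2 ^ J := by
  rw [Nat.div_eq_iff (by positivity)]
  have : 0 < 2 ^ J := by positivity
  rw [Nat.add_mul]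
  omega

theorem cell_eq_Ico (hi : i < n) (hf : (a + 1) * 2 ^ J ≤ T * n) :
    cell n i T J a = Finset.Ico (numBelow n i (a * 2 ^ J)) (numBelow n i ((a + 1) * 2 ^ J)) := by
  ext r
  rw [cell, Finset.mem_filter, Finset.mem_Ico, lt_numBelow_iff hi, ← not_lt, lt_numBelow_iff hi,
    div_two_pow_eq_iff, Finset.mem_range, not_lt]
  refine ⟨fun h => h.2, fun h => ⟨?_, h⟩⟩
  have : r * n < T * n := by omega
  exact lt_of_mul_lt_mul_right this (Nat.zero_le n)

theorem card_cell (hi : i < n) (hf : (a + 1) * 2 ^ J ≤ T * n) :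
    (cell n i T J a).card = numBelow n i ((a + 1) * 2 ^ J) - numBelow n i (a * 2 ^ J) := by
  rw [cell_eq_Ico hi hf, Nat.card_Ico]

theorem numBelow_mono {z z' : ℕ} (h : z ≤ z') : numBelow n i z ≤ numBelow n i z' :=
  Nat.div_le_div_right (by omega)

/-- The second difference of `⌊x / n⌋` with any step is at most `1` in absolute value; apply this to
the three endpoints of the two halves. -/
theorem card_cell_halves (hi : i < n) (hf : (a + 1) * 2 ^ (J + 1) ≤ T * n) :
    (cell n i T J (2 * a)).card ≤ (cell n i T J (2 * a + 1)).card + 1 ∧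
      (cell n i T J (2 * a + 1)).card ≤ (cell n i T J (2 * a)).card + 1 := by
  have e2 : (a + 1) * 2 ^ (J + 1) = (2 * a + 1 + 1) * 2 ^ J := by ring
  rw [e2] at hf
  have hle : (2 * a + 1) * 2 ^ J ≤ (2 * a + 1 + 1) * 2 ^ J := Nat.mul_le_mul_right _ (by omega)
  rw [card_cell hi (hle.trans hf), card_cell hi hf]
  have m1 : numBelow n i (2 * a * 2 ^ J) ≤ numBelow n i ((2 * a + 1) * 2 ^ J) :=
    numBelow_mono (Nat.mul_le_mul_right _ (by omega))
  have m2 : numBelow n i ((2 * a + 1) * 2 ^ J) ≤ numBelow n i ((2 * a + 1 + 1) * 2 ^ J) :=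
    numBelow_mono hle
  have h1 := two_mul_add_div_le (n := n) (by omega) (2 * a * 2 ^ J + (n - 1 - i)) (2 ^ J)
  have h2 := div_add_div_le (n := n) (by omega) (2 * a * 2 ^ J + (n - 1 - i)) (2 ^ J)
  have e3 : 2 * a * 2 ^ J + (n - 1 - i) + 2 ^ J = (2 * a + 1) * 2 ^ J + (n - 1 - i) := by ring
  have e4 : 2 * a * 2 ^ J + (n - 1 - i) + 2 * 2 ^ J = (2 * a + 1 + 1) * 2 ^ J + (n - 1 - i) := by
    ring
  rw [e3, e4] at h1 h2
  unfold numBelow at *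
  omega

theorem card_cell_pos (hi : i < n) (hf : (a + 1) * 2 ^ J ≤ T * n) (hJ : n ≤ 2 ^ J) :
    0 < (cell n i T J a).card := by
  rw [card_cell hi hf]
  have : numBelow n i (a * 2 ^ J) + 1 ≤ numBelow n i ((a + 1) * 2 ^ J) := by
    unfold numBelow
    rw [← Nat.add_div_right _ (by omega)]
    exact Nat.div_le_div_right (by rw [Nat.add_mul]; omega)
  omega

theorem card_cell_le_one (hi : i < n) (hf : (a + 1) * 2 ^ J ≤ T * n) (hJ : 2 ^ J ≤ n) :
    (cell n i T J a).card ≤ 1 := by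
  rw [card_cell hi hf]
  have : numBelow n i ((a + 1) * 2 ^ J) ≤ numBelow n i (a * 2 ^ J) + 1 := by
    unfold numBelow
    rw [← Nat.add_div_right _ (by omega)]
    exact Nat.div_le_div_right (by rw [Nat.add_mul]; omega)
  omega

/-- A lower bound on the surplus of binary digits `1` in a complete dyadic interval that contains
`x` of the times. -/
def surplus (x : ℕ) : ℤ :=
  if _h : x ≤ 1 then 0 else
    2 * (x / 2 : ℕ) - (x - x / 2 : ℕ) + surplus (x / 2) + surplus (x - x / 2)
decreasing_by all_goals omega

theorem surplus_of_le_one {x : ℕ} (h : x ≤ 1) : surplus x = 0 := by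
  rw [surplus]; simp [h]

theorem surplus_double {m : ℕ} (hm : 1 ≤ m) : surplus (2 * m) = m + 2 * surplus m := by
  rw [surplus, dif_neg (by omega), show 2 * m / 2 = m by omega, show 2 * m - m = m by omega]
  ring

theorem surplus_double_add_one {m : ℕ} (hm : 1 ≤ m) :
    surplus (2 * m + 1) = m - 1 + surplus m + surplus (m + 1) := by
  rw [surplus, dif_neg (by omega), show (2 * m + 1) / 2 = m by omega,
    show 2 * m + 1 - m = m + 1 by omega]
  push_cast; ring

theorem surplus_nonneg (x : ℕ) : 0 ≤ surplus x := by
  induction x using Nat.strong_induction_on with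
  | _ x ih =>
    rcases Nat.lt_or_ge x 2 with h | h
    · rw [surplus_of_le_one (by omega)]
    · obtain ⟨m, rfl | rfl⟩ := Nat.even_or_odd' x
      · rw [surplus_double (by omega)]
        have := ih m (by omega)
        omega
      · rw [surplus_double_add_one (by omega)]
        have := ih m (by omega)
        have := ih (m + 1) (by omega)
        omega

/-- The recursion for `surplus` puts the smaller half on the right, which is the worst case: among
the almost balanced splittings it minimizes the gain `2 * y - x`. The case `y = 0` is excluded,
since there the gain would be negative. -/
theorem surplus_add_le {x y : ℕ} (hxy : x ≤ y + 1) (hyx : y ≤ x + 1) (hy : 1 ≤ y) :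
    surplus (x + y) ≤ 2 * y - x + surplus x + surplus y := by
  obtain h | h | h : x = y + 1 ∨ x = y ∨ y = x + 1 := by omega
  · subst h
    rw [show y + 1 + y = 2 * y + 1 by ring, surplus_double_add_one hy]
    push_cast; linarith
  · subst h
    rw [← two_mul, surplus_double hy]; linarith
  · subst h
    rcases Nat.eq_zero_or_pos x with rfl | hx
    · simp [surplus_of_le_one]
    · rw [show x + (x + 1) = 2 * x + 1 by ring, surplus_double_add_one hx]
      push_cast; linarith

/-- Doubling `x` doubles the surplus and adds about half of the new size, so a linear bound
propagates from `8, …, 15`. It fails at `7`, where the surplus is `7`. -/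
theorem lt_surplus {x : ℕ} (hx : 8 ≤ x) : (x : ℤ) + 1 ≤ surplus x := by
  have h2 : surplus 2 = 1 := by
    have := surplus_double (m := 1) le_rfl; rwa [surplus_of_le_one le_rfl] at this
  have h3 : surplus 3 = 1 := by
    have := surplus_double_add_one (m := 1) le_rfl
    simpa [surplus_of_le_one, h2] using this
  have h4 : surplus 4 = 4 := by
    have := surplus_double (m := 2) (by omega); simpa [h2] using this
  have h5 : surplus 5 = 3 := by
    have := surplus_double_add_one (m := 2) (by omega); simpa [h2, h3] using this
  have h6 : surplus 6 = 5 := by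
    have := surplus_double (m := 3) (by omega); simpa [h3] using this
  have h7 : surplus 7 = 7 := by
    have := surplus_double_add_one (m := 3) (by omega); simpa [h3, h4] using this
  induction x using Nat.strong_induction_on with
  | _ x ih =>
    obtain ⟨m, rfl | rfl⟩ := Nat.even_or_odd' x
    · rw [surplus_double (by omega)]
      rcases Nat.lt_or_ge m 8 with h | h
      · obtain rfl | rfl | rfl | rfl : m = 4 ∨ m = 5 ∨ m = 6 ∨ m = 7 := by omega
        all_goals omega
      · have := ih m (by omega) h
        omega
    · rw [surplus_double_add_one (by omega)]
      rcases Nat.lt_or_ge m 8 with h | h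
      · have h8 : surplus 8 = 12 := by
          have := surplus_double (m := 4) (by omega); simpa [h4] using this
        obtain rfl | rfl | rfl | rfl : m = 4 ∨ m = 5 ∨ m = 6 ∨ m = 7 := by omega
        all_goals norm_num; omega
      · have := ih m (by omega) h
        have := ih (m + 1) (by omega) (by omega)
        omega

/-- The binary expansions of `r * n + i` and of the end `s * n + n` of some round `s ≥ r` first
differ at place `j`. -/
def IsSplit (n i T r j : ℕ) : Prop :=
  (r * n + i) / 2 ^ j % 2 = 0 ∧
    ∃ s, r ≤ s ∧ s < T ∧ (s * n + n) / 2 ^ j = (r * n + i) / 2 ^ j + 1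

/-- No time `r' * n + i` lies in the dyadic interval that follows the one of `r * n + i`. -/
def NoNext (n i T r j : ℕ) : Prop :=
  ∀ r' < T, (r' * n + i) / 2 ^ j ≠ (r * n + i) / 2 ^ j + 1

open Classical in
/-- The excess of splits over twice the binary digits `1` at place `j`, where splits at the lowest
place `A` count only if the next dyadic interval is occupied. -/
def excess (n i T A r j : ℕ) : ℤ :=
  (if IsSplit n i T r j ∧ ¬ (j = A ∧ NoNext n i T r j) then 1 else 0) -
    2 * (if (r * n + i) / 2 ^ j % 2 = 1 then 1 else 0)

/-- The excess at the places in `[A, J)` of all times in a dyadic interval. -/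
def cellExcess (n i T A J a : ℕ) : ℤ :=
  ∑ r ∈ cell n i T J a, ∑ j ∈ Finset.Ico A J, excess n i T A r j

/-! ### Recursion of the excess over the halves of dyadic intervals -/

theorem disjoint_cell : Disjoint (cell n i T J (2 * a)) (cell n i T J (2 * a + 1)) := by
  rw [Finset.disjoint_left]
  intro r h1 h2
  simp only [cell, Finset.mem_filter] at h1 h2
  omega

theorem cell_succ :
    cell n i T (J + 1) a = cell n i T J (2 * a) ∪ cell n i T J (2 * a + 1) := by
  ext r
  simp only [cell, Finset.mem_filter, Finset.mem_union, Finset.mem_range, pow_succ,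
    ← Nat.div_div_eq_div_mul]
  omega

theorem card_cell_succ :
    (cell n i T (J + 1) a).card =
      (cell n i T J (2 * a)).card + (cell n i T J (2 * a + 1)).card := by
  rw [cell_succ, Finset.card_union_of_disjoint disjoint_cell]

theorem excess_right (h : r ∈ cell n i T J (2 * a + 1)) : excess n i T A r J = -2 := by
  simp only [cell, Finset.mem_filter] at h
  have h1 : (r * n + i) / 2 ^ J % 2 = 1 := by omega
  rw [excess, if_neg (by unfold IsSplit; omega), if_pos h1]; norm_num

theorem excess_left_le (h : r ∈ cell n i T J (2 * a)) : excess n i T A r J ≤ 1 := by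
  simp only [cell, Finset.mem_filter] at h
  rw [excess]
  split_ifs <;> omega

theorem cellExcess_succ (hA : A ≤ J) :
    cellExcess n i T A (J + 1) a = cellExcess n i T A J (2 * a) +
      cellExcess n i T A J (2 * a + 1) + ∑ r ∈ cell n i T J (2 * a), excess n i T A r J -
      2 * (cell n i T J (2 * a + 1)).card := by
  have h : ∑ r ∈ cell n i T J (2 * a + 1), excess n i T A r J =
      -2 * (cell n i T J (2 * a + 1)).card := by
    rw [Finset.sum_congr rfl fun r hr => excess_right hr]; simp; ring
  simp only [cellExcess, cell_succ, Finset.sum_union disjoint_cell,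
    Finset.sum_Ico_succ_top hA, Finset.sum_add_distrib, h]
  ring

theorem sum_excess_left_le :
    ∑ r ∈ cell n i T J (2 * a), excess n i T A r J ≤ (cell n i T J (2 * a)).card :=
  (Finset.sum_le_sum fun r hr => excess_left_le hr).trans (by simp)

theorem cellExcess_self : cellExcess n i T A A a = 0 := by simp [cellExcess]

/-- With `x` times in the left half and `y` in the right half, the top place contributes at most `x
- 2 * y`; the halves are complete and almost balanced, so induction reproduces the recursion of
`surplus`. -/
theorem cellExcess_le_of_full (hi : i < n) (hA : 2 ^ A ≤ n) (hA' : n < 2 ^ (A + 1)) (hJ : A ≤ J)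
    (hf : (a + 1) * 2 ^ J ≤ T * n) :
    cellExcess n i T A J a ≤ -surplus (cell n i T J a).card := by
  induction J, hJ using Nat.le_induction generalizing a with
  | base =>
    rw [cellExcess_self, surplus_of_le_one (card_cell_le_one hi hf hA), neg_zero]
  | succ J hJ ih =>
    have hf2 : (2 * a + 1 + 1) * 2 ^ J ≤ T * n := by
      rwa [show (2 * a + 1 + 1) * 2 ^ J = (a + 1) * 2 ^ (J + 1) by ring]
    have hf1 : (2 * a + 1) * 2 ^ J ≤ T * n :=
      (Nat.mul_le_mul_right _ (by omega)).trans hf2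
    have h1 := ih hf1
    have h2 := ih hf2
    have h3 := card_cell_halves hi hf
    rw [cellExcess_succ hJ, card_cell_succ]
    rcases Nat.eq_zero_or_pos (cell n i T J (2 * a + 1)).card with h0 | h0
    · have hJA : J = A := by
        by_contra hne
        have : n ≤ 2 ^ J := hA'.le.trans (Nat.pow_le_pow_right (by norm_num) (by omega))
        exact absurd (card_cell_pos hi hf2 this) (by omega)
      have h4 : ∑ r ∈ cell n i T J (2 * a), excess n i T A r J ≤ 0 := by
        refine Finset.sum_nonpos fun r hr => ?_
        have hN : NoNext n i T r J := by
          intro r' hr' h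
          rw [Finset.card_eq_zero] at h0
          simp only [cell, Finset.mem_filter] at hr
          have : r' ∈ cell n i T J (2 * a + 1) := by
            simp only [cell, Finset.mem_filter, Finset.mem_range]
            exact ⟨hr', by omega⟩
          simp [h0] at this
        rw [excess, if_neg (by tauto)]
        split_ifs <;> norm_num
      rw [h0] at h2 ⊢
      rw [surplus_of_le_one (Nat.zero_le 1)] at h2
      simp only [Nat.add_zero]
      push_cast
      linarith
    · have h5 := surplus_add_le h3.1 h3.2 h0
      have h6 := sum_excess_left_le (n := n) (i := i) (T := T) (A := A) (J := J) (a := a)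
      linarith

/-- The interval that contains `T * n` may be cut off. If it continues in the left half, the right
half is empty and no round end lies far enough for a split. Otherwise the left half is complete,
hence harmless, and `x - 2 * y + y ≤ x + y`. -/
theorem cellExcess_le_of_last (hi : i < n) (hA : 2 ^ A ≤ n) (hA' : n < 2 ^ (A + 1)) (hJ : A ≤ J) :
    cellExcess n i T A J (T * n / 2 ^ J) ≤ (cell n i T J (T * n / 2 ^ J)).card := by
  induction J, hJ using Nat.le_induction with
  | base => rw [cellExcess_self]; positivity
  | succ J hJ ih =>
    rw [cellExcess_succ hJ, card_cell_succ]
    have hdd : T * n / 2 ^ (J + 1) = T * n / 2 ^ J / 2 := by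
      rw [pow_succ, Nat.div_div_eq_div_mul]
    set q := T * n / 2 ^ J with hq
    obtain ⟨b, hb | hb⟩ := Nat.even_or_odd' q
    · have hlt : T * n < (2 * b + 1) * 2 ^ J := by
        have := (div_two_pow_eq_iff.1 hq.symm).2
        rwa [hb] at this
      rw [hdd, show q / 2 = b by omega]
      rw [hb] at ih
      have h0 : cell n i T J (2 * b + 1) = ∅ := by
        refine Finset.eq_empty_of_forall_notMem fun r hr => ?_
        simp only [cell, Finset.mem_filter, Finset.mem_range] at hr
        have := (div_two_pow_eq_iff.1 hr.2).1
        have : (r + 1) * n ≤ T * n := Nat.mul_le_mul_right _ hr.1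
        rw [Nat.add_mul] at this
        omega
      have h1 : cellExcess n i T A J (2 * b + 1) = 0 := by simp [cellExcess, h0]
      have h4 : ∑ r ∈ cell n i T J (2 * b), excess n i T A r J ≤ 0 := by
        refine Finset.sum_nonpos fun r hr => ?_
        have hN : ¬ IsSplit n i T r J := by
          rintro ⟨-, s, -, hs, h⟩
          simp only [cell, Finset.mem_filter] at hr
          rw [hr.2] at h
          have := (div_two_pow_eq_iff.1 h).1
          have : (s + 1) * n ≤ T * n := Nat.mul_le_mul_right _ hs
          rw [Nat.add_mul] at this
          omega
        rw [excess, if_neg (by tauto)]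
        split_ifs <;> norm_num
      rw [h1, h0]
      push_cast
      simp only [Finset.card_empty, Nat.cast_zero]
      linarith
    · have hle : (2 * b + 1) * 2 ^ J ≤ T * n := by
        have := (div_two_pow_eq_iff.1 hq.symm).1
        rwa [hb] at this
      rw [hdd, show q / 2 = b by omega]
      rw [hb] at ih
      have h1 := cellExcess_le_of_full hi hA hA' hJ hle
      have h2 := surplus_nonneg (cell n i T J (2 * b)).card
      have h6 := sum_excess_left_le (n := n) (i := i) (T := T) (A := A) (J := J) (a := b)
      push_cast
      linarith

theorem cell_zero_eq_range (hi : i < n) (h : T * n < 2 ^ J) :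
    cell n i T J 0 = Finset.range T := by
  ext r
  simp only [cell, Finset.mem_filter, Finset.mem_range, and_iff_left_iff_imp]
  intro hr
  have : (r + 1) * n ≤ T * n := Nat.mul_le_mul_right _ hr
  rw [Nat.add_mul] at this
  exact Nat.div_eq_of_lt (by omega)

theorem cellExcess_top_le (hi : i < n) (hA : 2 ^ A ≤ n) (hA' : n < 2 ^ (A + 1)) (hT : 10 ≤ T)
    (hJ : A ≤ J) (h1 : 2 ^ J ≤ T * n) (h2 : T * n < 2 ^ (J + 1)) :
    cellExcess n i T A (J + 1) 0 ≤ -1 := by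
  have hq : T * n / 2 ^ J = 1 := by
    rw [div_two_pow_eq_iff]; rw [pow_succ] at h2; omega
  have hl := cellExcess_le_of_last (T := T) hi hA hA' hJ
  rw [hq] at hl
  have hx := cellExcess_le_of_full (T := T) (a := 0) hi hA hA' hJ (by omega)
  have hs := sum_excess_left_le (n := n) (i := i) (T := T) (A := A) (J := J) (a := 0)
  have hc := card_cell_succ (n := n) (i := i) (T := T) (J := J) (a := 0)
  have hr := cell_zero_eq_range hi h2
  rw [hr, Finset.card_range] at hc
  rw [cellExcess_succ hJ]
  simp only [Nat.mul_zero, Nat.zero_add] at *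
  have h0 := surplus_nonneg (cell n i T J 0).card
  generalize (cell n i T J 0).card = x at *
  rcases Nat.lt_or_ge x 8 with h | h
  -- The collected bound is `2 * x - T - surplus x`. For `x < 5` it is negative because `T ≥ 10`;
  -- the values `5, 6, 7` need the exact surplus.
  · have h5 : surplus 5 = 3 := by simp [surplus]
    have h6 : surplus 6 = 5 := by simp [surplus]
    have h7 : surplus 7 = 7 := by simp [surplus]
    obtain h' | rfl | rfl | rfl : x < 5 ∨ x = 5 ∨ x = 6 ∨ x = 7 := by omega
    all_goals omega
  · have := lt_surplus h
    omega

/-! #### The places below `A` -/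

open Classical in
/-- The number of binary digits `1` of `r * n + i` below place `A`. -/
def lowOnes (n i A r : ℕ) : ℕ := ((Finset.range A).filter fun j => (r * n + i) / 2 ^ j % 2 = 1).card

open Classical in
/-- The places at most `A` of the splits that do not count towards the excess. -/
def lowSplits (n i T A r : ℕ) : Finset ℕ :=
  (Finset.range (A + 1)).filter fun j => IsSplit n i T r j ∧ (j = A → NoNext n i T r j)

/-- A low split can only be a split from the end of the same round. Below place `A`, the end of a
later round is at least two dyadic intervals away; at place `A`, it would force the time of the next
round into the next interval. -/
theorem div_add_one_eq_of_mem_lowSplits (hi : i < n) (hA : 2 ^ A ≤ n) (h : j ∈ lowSplits n i T A r) :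
    (r * n + n) / 2 ^ j = (r * n + i) / 2 ^ j + 1 := by
  simp only [lowSplits, Finset.mem_filter, Finset.mem_range] at h
  obtain ⟨hj, ⟨-, s, hrs, hsT, hs⟩, hN⟩ := h
  rcases hrs.eq_or_lt with rfl | hrs
  · exact hs
  exfalso
  have h1 : (r + 1) * n ≤ s * n := Nat.mul_le_mul_right _ hrs
  rcases Nat.lt_or_ge j A with hjA | hjA
  · have h2 : 2 ^ (j + 1) ≤ n := (Nat.pow_le_pow_right (by norm_num) hjA).trans hA
    have h3 : (r * n + i + 2 * 2 ^ j) / 2 ^ j ≤ (s * n + n) / 2 ^ j :=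
      Nat.div_le_div_right (by rw [pow_succ] at h2; rw [Nat.add_mul] at h1; omega)
    rw [Nat.add_mul_div_right _ _ (by positivity)] at h3
    omega
  · obtain rfl : j = A := by omega
    refine hN rfl (r + 1) (by omega) ?_
    have h3 : ((r + 1) * n + i) / 2 ^ j ≤ (s * n + n) / 2 ^ j :=
      Nat.div_le_div_right (by omega)
    have h4 : (r * n + i + 2 ^ j) / 2 ^ j ≤ ((r + 1) * n + i) / 2 ^ j :=
      Nat.div_le_div_right (by rw [Nat.add_mul]; omega)
    rw [Nat.add_div_right _ (by positivity)] at h4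
    omega

/-- All low splits compare the time with one and the same number, and two binary expansions have
only one highest place of difference. -/
theorem card_lowSplits_le_one (hi : i < n) (hA : 2 ^ A ≤ n) : (lowSplits n i T A r).card ≤ 1 := by
  have key : ∀ j j', j < j' → j ∈ lowSplits n i T A r → j' ∈ lowSplits n i T A r → False := by
    intro j j' hjj h h'
    have h1 := div_add_one_eq_of_mem_lowSplits hi hA h
    have h2 := div_add_one_eq_of_mem_lowSplits hi hA h'
    simp only [lowSplits, Finset.mem_filter] at h
    have h3 := h.2.1.1
    have h4 : (r * n + n) / 2 ^ (j + 1) = (r * n + i) / 2 ^ (j + 1) := by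
      rw [pow_succ, ← Nat.div_div_eq_div_mul, ← Nat.div_div_eq_div_mul, h1]; omega
    obtain ⟨c, rfl⟩ := Nat.exists_eq_add_of_le (Nat.succ_le_of_lt hjj)
    rw [Nat.succ_eq_add_one, pow_add, ← Nat.div_div_eq_div_mul, ← Nat.div_div_eq_div_mul, h4] at h2
    omega
  rw [Finset.card_le_one]
  intro j h j' h'
  by_contra hne
  rcases Nat.lt_or_gt_of_ne hne with hl | hl
  · exact key _ _ hl h h'
  · exact key _ _ hl h' h

theorem mod_eq_zero_of_lowOnes (h : lowOnes n i A r = 0) : (r * n + i) % 2 ^ A = 0 := by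
  apply Nat.eq_of_testBit_eq
  intro j
  rw [Nat.testBit_mod_two_pow, Nat.zero_testBit]
  rw [lowOnes, Finset.card_eq_zero, Finset.filter_eq_empty_iff] at h
  by_cases hj : j < A
  · have := h (Finset.mem_range.2 hj)
    simp [Nat.testBit_eq_decide_div_mod_eq, this]
  · simp [hj]

/-- If two consecutive times had no digit `1` below `A`, then `2 ^ A` would divide both, which
forces `n = 2 ^ A` and `i = 0`. The split is then at place `A`, and the next time occupies the next
interval, contrary to `NoNext`. -/
theorem lowSplits_next (hi : i < n) (hA : 2 ^ A ≤ n) (hA' : n < 2 ^ (A + 1)) (hr : r + 1 < T)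
    (h0 : lowOnes n i A r = 0) (h1 : (lowSplits n i T A r).Nonempty) :
    lowOnes n i A (r + 1) ≠ 0 := by
  intro h2
  obtain ⟨j, hj⟩ := h1
  have h3 := div_add_one_eq_of_mem_lowSplits hi hA hj
  have d0 := Nat.dvd_of_mod_eq_zero (mod_eq_zero_of_lowOnes h0)
  have d1 := Nat.dvd_of_mod_eq_zero (mod_eq_zero_of_lowOnes h2)
  have d2 : 2 ^ A ∣ n := by
    have := Nat.dvd_sub d1 d0
    rwa [show (r + 1) * n + i - (r * n + i) = n by rw [Nat.add_mul]; omega] at this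
  have hn : n = 2 ^ A := by
    obtain ⟨c, rfl⟩ := d2
    rw [pow_succ] at hA'
    have hc : c < 2 := lt_of_mul_lt_mul_left hA' (by positivity)
    obtain rfl | rfl : c = 0 ∨ c = 1 := by omega
    · omega
    · omega
  have hi0 : i = 0 := by
    have : 2 ^ A ∣ i := (Nat.dvd_add_right (d2.mul_left r)).1 d0
    exact Nat.eq_zero_of_dvd_of_lt this (by omega)
  subst hi0
  simp only [lowSplits, Finset.mem_filter, Finset.mem_range] at hj
  obtain ⟨c, hc⟩ := Nat.exists_eq_add_of_le (Nat.lt_succ_iff.1 hj.1)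
  have h4 : (r * n + n) / 2 ^ j = (r * n + 0) / 2 ^ j + 2 ^ c := by
    have : r * n + n = r * n + 0 + 2 ^ c * 2 ^ j := by
      rw [← pow_add, Nat.add_comm c, ← hc, ← hn]; rfl
    rw [this, Nat.add_mul_div_right _ _ (by positivity)]
  have hc0 : c = 0 := by
    by_contra hne
    have := Nat.one_lt_two_pow hne
    omega
  subst hc0
  refine hj.2.2 (by omega) (r + 1) hr ?_
  rw [← h3, Nat.add_mul, Nat.one_mul, Nat.add_zero]

theorem sum_lowSplits_le (hi : i < n) (hA : 2 ^ A ≤ n) (hA' : n < 2 ^ (A + 1)) :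
    ∑ r ∈ Finset.range T, (((lowSplits n i T A r).card : ℤ) - 2 * lowOnes n i A r) ≤ 1 := by
  have h1 : ∀ r, (lowSplits n i T A r).card ≤ 1 := fun r => card_lowSplits_le_one hi hA
  -- A partial sum equals `1` only directly after a round with a low split and no low digit `1`. The
  -- round after such a round has a low digit `1` and contributes at most `1 - 2`.
  have key : ∀ m ≤ T, ∑ r ∈ Finset.range m,
      (((lowSplits n i T A r).card : ℤ) - 2 * lowOnes n i A r) ≤ 0 ∨
      (∑ r ∈ Finset.range m, (((lowSplits n i T A r).card : ℤ) - 2 * lowOnes n i A r) ≤ 1 ∧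
        ∃ r, m = r + 1 ∧ (lowSplits n i T A r).card = 1 ∧ lowOnes n i A r = 0) := by
    intro m hm
    induction m with
    | zero => simp
    | succ m ih =>
      rw [Finset.sum_range_succ]
      have := h1 m
      rcases ih (by omega) with h | ⟨h, r, rfl, hr1, hr0⟩
      · by_cases hp : (lowSplits n i T A m).card = 1 ∧ lowOnes n i A m = 0
        · exact Or.inr ⟨by omega, m, rfl, hp⟩
        · left; omega
      · have := lowSplits_next (T := T) hi hA hA' (by omega) hr0 (Finset.card_pos.1 (by omega))
        left; omega
  rcases key T le_rfl with h | h
  · omega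
  · exact h.1

open Classical in
/-- Among the binary expansions of the times `r * n + i`, `r < T`, the splits are at most twice as
many as the digits `1`. -/
theorem sum_card_splits_le (hi : i < n) (hT : 10 ≤ T) :
    ∑ r ∈ Finset.range T,
        ((Finset.range (levels (n * T))).filter fun j => IsSplit n i T r j).card ≤
      2 * ∑ r ∈ Finset.range T,
        ((Finset.range (levels (n * T))).filter fun j => (r * n + i) / 2 ^ j % 2 = 1).card := by
  have hn : n ≠ 0 := by omega
  have hN : T * n ≠ 0 := Nat.mul_ne_zero (by omega) hn
  rw [Nat.mul_comm n T, levels]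
  set J := Nat.log 2 (T * n) with hJ
  set A := Nat.log 2 n with hA
  have a1 : 2 ^ A ≤ n := Nat.pow_log_le_self 2 hn
  have a2 : n < 2 ^ (A + 1) := Nat.lt_pow_succ_log_self (by norm_num) n
  have j1 : 2 ^ J ≤ T * n := Nat.pow_log_le_self 2 hN
  have j2 : T * n < 2 ^ (J + 1) := Nat.lt_pow_succ_log_self (by norm_num) _
  have hAJ : A ≤ J := Nat.log_mono_right (Nat.le_mul_of_pos_left n (by omega))
  have h1 := cellExcess_top_le hi a1 a2 hT hAJ j1 j2
  have h2 := sum_lowSplits_le (T := T) hi a1 a2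
  have hr := cell_zero_eq_range hi j2
  rw [cellExcess, hr] at h1
  have h3 : ∀ r ∈ Finset.range T,
      (((Finset.range (J + 1)).filter fun j => IsSplit n i T r j).card : ℤ) -
        2 * ((Finset.range (J + 1)).filter fun j => (r * n + i) / 2 ^ j % 2 = 1).card ≤
      (((lowSplits n i T A r).card : ℤ) - 2 * lowOnes n i A r) +
        ∑ j ∈ Finset.Ico A (J + 1), excess n i T A r j := by
    intro r _
    have e1 : (((Finset.range (J + 1)).filter fun j => (r * n + i) / 2 ^ j % 2 = 1).card : ℤ) =
        lowOnes n i A r +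
          ∑ j ∈ Finset.Ico A (J + 1), if (r * n + i) / 2 ^ j % 2 = 1 then 1 else 0 := by
      rw [lowOnes, Finset.card_filter, Finset.card_filter]
      push_cast
      exact (Finset.sum_range_add_sum_Ico _ (by omega)).symm
    -- The splits at place `A` are divided: those without a next time are low, the others belong to
    -- the excess.
    have e2 : (((Finset.range (J + 1)).filter fun j => IsSplit n i T r j).card : ℤ) ≤
        (lowSplits n i T A r).card + ∑ j ∈ Finset.Ico A (J + 1),
          if IsSplit n i T r j ∧ ¬ (j = A ∧ NoNext n i T r j) then 1 else 0 := by
      rw [← Finset.natCast_card_filter, ← Nat.cast_add, Nat.cast_le]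
      refine le_trans (Finset.card_le_card fun j hj => ?_) (Finset.card_union_le _ _)
      simp only [lowSplits, Finset.mem_union, Finset.mem_filter, Finset.mem_range,
        Finset.mem_Ico] at hj ⊢
      by_cases hb : j < A ∨ (j = A ∧ NoNext n i T r j)
      · refine Or.inl ⟨by omega, hj.2, fun h => ?_⟩
        rcases hb with hb | hb
        · omega
        · exact hb.2
      · push Not at hb
        exact Or.inr ⟨⟨hb.1, hj.1⟩, hj.2, fun h => hb.2 h.1 h.2⟩
    rw [e1]
    simp only [excess, Finset.sum_sub_distrib, ← Finset.mul_sum]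
    linarith
  have h4 := Finset.sum_le_sum h3
  rw [Finset.sum_sub_distrib, Finset.sum_add_distrib, ← Finset.mul_sum] at h4
  rw [← Nat.cast_le (α := ℤ)]
  simp only [Nat.cast_mul, Nat.cast_sum, Nat.cast_ofNat]
  linarith

end DyadicCount

/-! ### Translates of the Laplace distribution -/

/-- By the triangle inequality in the exponent, the translated density is at most `exp (|v| / b)`
times the original one, pointwise. -/
theorem map_add_laplace_le {b : ℝ} (hb : 0 < b) (v : ℝ) :
    (laplace b).map (· + v) ≤ ENNReal.ofReal (Real.exp (|v| / b)) • laplace b := by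
  refine Measure.le_intro fun s hs _ => ?_
  have hmeas : Measurable fun x : ℝ => ENNReal.ofReal (Real.exp (-|x| / b) / (2 * b)) := by
    fun_prop
  rw [Measure.map_apply (measurable_add_const v) hs, Measure.smul_apply, smul_eq_mul, laplace,
    withDensity_apply _ hs, withDensity_apply _ (measurable_add_const v hs),
    ← lintegral_const_mul _ hmeas, ← lintegral_indicator (measurable_add_const v hs),
    ← lintegral_indicator hs,
    ← lintegral_add_right_eq_self (s.indicator _) v]
  refine lintegral_mono fun x => ?_
  by_cases hx : x + v ∈ s
  · rw [Set.indicator_of_mem (show x ∈ (· + v) ⁻¹' s from hx), Set.indicator_of_mem hx,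
      ← ENNReal.ofReal_mul (Real.exp_nonneg _)]
    refine ENNReal.ofReal_le_ofReal ?_
    rw [← mul_div_assoc, ← Real.exp_add, ← add_div]
    gcongr
    linarith [abs_add_le x v]
  · rw [Set.indicator_of_notMem (show x ∉ (· + v) ⁻¹' s from hx), Set.indicator_of_notMem hx]

theorem pi_le_smul_pi {ι : Type*} [Fintype ι] {X : ι → Type*} [∀ i, MeasurableSpace (X i)]
    (μ ν : ∀ i, Measure (X i)) [∀ i, SigmaFinite (μ i)] [∀ i, SigmaFinite (ν i)]
    (c : ι → ENNReal) (hc : ∀ i, c i ≠ 0) (hc' : ∀ i, c i ≠ ⊤) (h : ∀ i, μ i ≤ c i • ν i) :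
    Measure.pi μ ≤ (∏ i, c i) • Measure.pi ν := by
  have h0 : ∏ i, c i ≠ 0 := Finset.prod_ne_zero_iff.2 fun i _ => hc i
  have h1 : ∏ i, c i ≠ ⊤ := ENNReal.prod_ne_top fun i _ => hc' i
  -- The product outer measure is the largest one bounded on boxes by the products, so it suffices
  -- to compare boxes; the constant is moved to the left to use this maximality.
  have key : (∏ i, c i)⁻¹ • (Measure.pi μ).toOuterMeasure ≤
      OuterMeasure.pi fun i => (ν i).toOuterMeasure := by
    rw [OuterMeasure.le_pi]
    intro s _
    rw [smul_apply, smul_eq_mul, Measure.coe_toOuterMeasure, Measure.pi_pi]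
    calc (∏ i, c i)⁻¹ * ∏ i, μ i (s i) ≤ (∏ i, c i)⁻¹ * ∏ i, (c i * ν i (s i)) := by
          gcongr with i
          exact h i (s i)
      _ = ∏ i, ν i (s i) := by
          rw [Finset.prod_mul_distrib, ← mul_assoc, ENNReal.inv_mul_cancel h0 h1, one_mul]
  refine Measure.le_intro fun s hs _ => ?_
  have h2 : (∏ i, c i)⁻¹ * Measure.pi μ s ≤ Measure.pi ν s := by
    rw [Measure.pi_def ν, toMeasure_apply _ _ hs]
    exact key s
  rw [Measure.smul_apply, smul_eq_mul]
  calc Measure.pi μ s = (∏ i, c i) * ((∏ i, c i)⁻¹ * Measure.pi μ s) := by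
        rw [← mul_assoc, ENNReal.mul_inv_cancel h0 h1, one_mul]
    _ ≤ _ := by gcongr

theorem pi_laplace_translate_le {ι : Type*} [Fintype ι] {b : ℝ} (hb : 0 < b) (v : ι → ℝ)
    {B : Set (ι → ℝ)} (hB : MeasurableSet B) :
    Measure.pi (fun _ : ι => laplace b) ((· + v) ⁻¹' B) ≤
      ENNReal.ofReal (Real.exp ((∑ i, |v i|) / b)) * Measure.pi (fun _ : ι => laplace b) B := by
  have := isProbabilityMeasure_laplace hb
  have : ∀ i, IsProbabilityMeasure ((laplace b).map (· + v i)) := fun i =>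
    Measure.isProbabilityMeasure_map (measurable_add_const (v i)).aemeasurable
  have h := pi_le_smul_pi (fun i => (laplace b).map (· + v i)) (fun _ : ι => laplace b)
    (fun i => ENNReal.ofReal (Real.exp (|v i| / b)))
    (fun i => by simpa using Real.exp_pos _) (fun i => ENNReal.ofReal_ne_top)
    (fun i => map_add_laplace_le hb (v i)) B
  rw [← Measure.pi_map_pi (fun i => (measurable_add_const (v i)).aemeasurable),
    Measure.map_apply (by fun_prop) hB, Measure.smul_apply, smul_eq_mul,
    ← ENNReal.ofReal_prod_of_nonneg (fun i _ => Real.exp_nonneg _), ← Real.exp_sum,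
    ← Finset.sum_div] at h
  exact h

/-- Two outputs of a mechanism with Laplace noise are indistinguishable if they are a common
function `F` of the noise after integral shifts `a`, `a'` that depend on the shifted noise and
never differ by more than `c` in total. -/
theorem measure_le_of_shift {ι R : Type*} [Fintype ι] {b c ε : ℝ} (hb : 0 < b)
    (hc : c / b ≤ ε) {out out' F : (ι → ℝ) → R} {a a' α α' : (ι → ℝ) → ι → ℝ}
    (ha : Measurable a) (ha' : Measurable a')
    (hint : ∀ y, ∃ z : ι → ℤ, ∀ i, a y i = z i) (hint' : ∀ y, ∃ z : ι → ℤ, ∀ i, a' y i = z i)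
    (hα : ∀ ω, a (ω + α ω) = α ω) (hα' : ∀ y, α' (y - a' y) = a' y)
    (hout : ∀ ω, F (ω + α ω) = out ω) (hout' : ∀ y, out' (y - a' y) = F y)
    (hdiff : ∀ y, ∑ i, |a y i - a' y i| ≤ c)
    (S : Set R) (hS : MeasurableSet (F ⁻¹' S)) :
    Measure.pi (fun _ : ι => laplace b) (out ⁻¹' S) ≤
      ENNReal.ofReal (Real.exp ε) * Measure.pi (fun _ : ι => laplace b) (out' ⁻¹' S) := by
  set μ := Measure.pi (fun _ : ι => laplace b)
  let r : (ι → ℤ) → ι → ℝ := fun z i => z i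
  have hr : Function.Injective r := fun z z' h => by
    funext i; exact Int.cast_injective (congrFun h i)
  -- On such a piece both shifts are constant, so both preimages are translates of one set;
  -- integrality makes the pieces countable.
  let B : (ι → ℤ) × (ι → ℤ) → Set (ι → ℝ) := fun q =>
    {y | a y = r q.1 ∧ a' y = r q.2 ∧ F y ∈ S}
  have hB : ∀ q, MeasurableSet (B q) := fun q =>
    (ha (measurableSet_singleton _)).inter ((ha' (measurableSet_singleton _)).inter hS)
  have hsub : out ⁻¹' S ⊆ ⋃ q, (· + r q.1) ⁻¹' B q := by
    intro ω hω
    obtain ⟨z, hz⟩ := hint (ω + α ω)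
    obtain ⟨z', hz'⟩ := hint' (ω + α ω)
    have e : α ω = r z := by rw [← hα]; exact funext hz
    refine Set.mem_iUnion.2 ⟨(z, z'), ?_⟩
    change a (ω + r z) = r z ∧ a' (ω + r z) = r z' ∧ F (ω + r z) ∈ S
    rw [← e]
    exact ⟨hα ω, funext hz', by rw [hout]; exact hω⟩
  have hsub' : (⋃ q, (· + r q.2) ⁻¹' B q) ⊆ out' ⁻¹' S := by
    refine Set.iUnion_subset fun q ω hω => ?_
    obtain ⟨-, h2, h3⟩ := hω
    have := hout' (ω + r q.2)
    rw [h2, add_sub_cancel_right] at this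
    rw [Set.mem_preimage, this]; exact h3
  -- The seed determines its own shift through `α'`, hence `q.2`, hence the point `y` and with it
  -- `q.1`. On the other side a union bound suffices, so disjointness is needed only here.
  have hdisj : Pairwise (Function.onFun Disjoint fun q => (· + r q.2) ⁻¹' B q) := by
    intro q q' hne
    refine Set.disjoint_left.2 fun ω h h' => hne ?_
    obtain ⟨h1, h2, -⟩ := h
    obtain ⟨h1', h2', -⟩ := h'
    have e := hα' (ω + r q.2)
    have e' := hα' (ω + r q'.2)
    rw [h2, add_sub_cancel_right] at e
    rw [h2', add_sub_cancel_right] at e'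
    have e2 : q.2 = q'.2 := hr (e.symm.trans e')
    rw [← e2] at h1'
    exact Prod.ext (hr (h1.symm.trans h1')) e2
  have hle : ∀ q, μ ((· + r q.1) ⁻¹' B q) ≤
      ENNReal.ofReal (Real.exp ε) * μ ((· + r q.2) ⁻¹' B q) := by
    intro q
    rcases (B q).eq_empty_or_nonempty with h | ⟨y, h1, h2, -⟩
    · simp [h]
    -- The first preimage is the second one translated by `r q.1 - r q.2`; a point of the piece
    -- turns `hdiff` into a bound for this vector.
    · have hm : MeasurableSet ((· + r q.2) ⁻¹' B q) := measurable_add_const _ (hB q)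
      have h := pi_laplace_translate_le hb (r q.1 - r q.2) hm
      rw [← Set.preimage_comp] at h
      have e : ((· + r q.2) ∘ (· + (r q.1 - r q.2)) : (ι → ℝ) → ι → ℝ) = (· + r q.1) := by
        funext x; simp [add_assoc]
      rw [e] at h
      refine h.trans ?_
      gcongr
      refine le_trans ?_ hc
      gcongr
      rw [← h1, ← h2]
      exact hdiff y
  calc μ (out ⁻¹' S) ≤ μ (⋃ q, (· + r q.1) ⁻¹' B q) := measure_mono hsub
    _ ≤ ∑' q, μ ((· + r q.1) ⁻¹' B q) := measure_iUnion_le _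
    _ ≤ ∑' q, ENNReal.ofReal (Real.exp ε) * μ ((· + r q.2) ⁻¹' B q) := ENNReal.tsum_le_tsum hle
    _ = ENNReal.ofReal (Real.exp ε) * μ (⋃ q, (· + r q.2) ⁻¹' B q) := by
        rw [ENNReal.tsum_mul_left, measure_iUnion hdisj fun q => measurable_add_const _ (hB q)]
    _ ≤ _ := by gcongr

/-! ### The nodes of the binary mechanism -/

/-- The sum of the stream over the dyadic interval whose partial sum is formed at time `τ`. -/
def nodeSum (σ : ℕ → ℝ) (τ : ℕ) : ℝ :=
  ∑ u ∈ Finset.Ioc (τ - 2 ^ padicValNat 2 τ) τ, σ u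

/-- The sum of `f` over the times at which the partial sums in the reading at time `t` were
formed. -/
def sumNodes (f : ℕ → ℝ) (t : ℕ) : ℝ :=
  ∑ j ∈ (Finset.range (levels t)).filter (fun j => t.testBit j = true), f (t / 2 ^ j * 2 ^ j)

/-- The quotient is odd, so the level of a node can be read off its time. Thus nodes are indexed by
time alone, with one noise each. -/
theorem padicValNat_node {t j : ℕ} (h : t.testBit j = true) :
    padicValNat 2 (t / 2 ^ j * 2 ^ j) = j := by
  rw [Nat.testBit_eq_decide_div_mod_eq, decide_eq_true_eq] at h
  have h0 : t / 2 ^ j ≠ 0 := by intro h0; simp [h0] at h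
  rw [padicValNat.mul h0 (by positivity), padicValNat.prime_pow,
    padicValNat.eq_zero_of_not_dvd (by omega), zero_add]

theorem binaryMechanism_eq_sumNodes (σ η : ℕ → ℝ) (t : ℕ) :
    binaryMechanism σ η t = sumNodes (fun τ => nodeSum σ τ + η τ) t := by
  refine Finset.sum_congr rfl fun j hj => ?_
  change _ = nodeSum σ (t / 2 ^ j * 2 ^ j) + _
  rw [nodeSum, padicValNat_node (Finset.mem_filter.1 hj).2]

theorem node_pos {t j : ℕ} (h : t.testBit j = true) : 0 < t / 2 ^ j * 2 ^ j := by
  rw [Nat.testBit_eq_decide_div_mod_eq, decide_eq_true_eq] at h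
  have h0 : t / 2 ^ j ≠ 0 := by intro h0; simp [h0] at h
  positivity

/-- The partial sum formed at time `τ` appears in a reading at the end of one of the rounds
`0, …, T - 1`. -/
def Observed (n T τ : ℕ) : Prop :=
  ∃ s < T, ∃ j, (s * n + n).testBit j = true ∧ τ = (s * n + n) / 2 ^ j * 2 ^ j

/-- The dyadic interval whose partial sum is formed at time `τ`. -/
def nodeInterval (τ : ℕ) : Finset ℕ := Finset.Ioc (τ - 2 ^ padicValNat 2 τ) τ

/-! ### Nodes that contain a given time -/

theorem div_of_mem_nodeInterval {τ w : ℕ} (hτ : 0 < τ) (h : w + 1 ∈ nodeInterval τ) :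
    ∃ m, τ = (2 * m + 1) * 2 ^ padicValNat 2 τ ∧ w / 2 ^ padicValNat 2 τ = 2 * m := by
  rw [nodeInterval, Finset.mem_Ioc] at h
  obtain ⟨c, hc⟩ := pow_padicValNat_dvd (p := 2) (n := τ)
  have hodd : ¬ 2 ∣ c := by
    rintro ⟨d, rfl⟩
    refine pow_succ_padicValNat_not_dvd (p := 2) hτ.ne' ⟨d, ?_⟩
    rw [pow_succ, mul_assoc]; exact hc
  set j := padicValNat 2 τ
  obtain ⟨m, rfl | rfl⟩ := Nat.even_or_odd' c
  · omega
  · have e : 2 ^ j * (2 * m + 1) = 2 * m * 2 ^ j + 2 ^ j := by ring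
    refine ⟨m, by rw [mul_comm]; exact hc, ?_⟩
    rw [DyadicCount.div_two_pow_eq_iff, Nat.add_mul]
    omega

theorem padicValNat_injOn {w N : ℕ} :
    Set.InjOn (fun q : Fin N => padicValNat 2 (q + 1))
      {q | w + 1 ∈ nodeInterval (q + 1)} := by
  intro q hq q' hq' h
  simp only at h
  obtain ⟨m, h1, h2⟩ := div_of_mem_nodeInterval (Nat.add_one_pos _) hq
  obtain ⟨m', h1', h2'⟩ := div_of_mem_nodeInterval (Nat.add_one_pos _) hq'
  rw [← h] at h1' h2'
  have : m = m' := by omega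
  subst this
  have := h1.trans h1'.symm
  exact Fin.ext (by omega)

theorem padicValNat_lt_levels {N : ℕ} (q : Fin N) : padicValNat 2 (q + 1) < levels N := by
  rw [levels, Nat.lt_succ_iff]
  refine Nat.le_log_of_pow_le (by norm_num) ?_
  exact (Nat.le_of_dvd (Nat.succ_pos _) pow_padicValNat_dvd).trans q.2

/-- The level maps the nodes that contain time `w + 1` injectively into the places where `w` has
digit `0`. The shift by one matters: node intervals are closed on the right. -/
theorem card_nodes_add_card_ones_le (w N : ℕ) :
    (Finset.univ.filter fun q : Fin N => w + 1 ∈ nodeInterval (q + 1)).card +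
      ((Finset.range (levels N)).filter fun j => w / 2 ^ j % 2 = 1).card ≤ levels N := by
  have h := Finset.card_le_card_of_injOn (s := Finset.univ.filter fun q : Fin N =>
      w + 1 ∈ nodeInterval (q + 1)) (t := (Finset.range (levels N)).filter fun j =>
      ¬ w / 2 ^ j % 2 = 1) (fun q => padicValNat 2 (q + 1)) (fun q hq => by
        simp only [Finset.coe_filter, Finset.mem_univ, true_and, Set.mem_ofPred_eq] at hq
        obtain ⟨m, -, h2⟩ := div_of_mem_nodeInterval (Nat.add_one_pos _) hq
        simp only [Finset.coe_filter, Finset.mem_range, Set.mem_ofPred_eq]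
        exact ⟨padicValNat_lt_levels q, by omega⟩)
      (fun q hq q' hq' h => padicValNat_injOn (w := w) (by simpa using hq) (by simpa using hq') h)
  have h2 := Finset.card_filter_add_card_filter_not (s := Finset.range (levels N))
    (fun j => w / 2 ^ j % 2 = 1)
  rw [Finset.card_range] at h2
  omega

open Classical in
-- An observed node at level `j` ends at the truncation of a round end. It contains `w + 1` exactly
-- when `w` lies in the preceding interval of length `2 ^ j`, which is a split at place `j`.
theorem card_observed_nodes_le {n i T : ℕ} (r N : ℕ) :
    (Finset.univ.filter fun q : Fin N =>
        r * n + i + 1 ∈ nodeInterval (q + 1) ∧ Observed n T (q + 1)).card ≤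
      ((Finset.range (levels N)).filter fun j => DyadicCount.IsSplit n i T r j).card := by
  refine Finset.card_le_card_of_injOn (fun q => padicValNat 2 (q + 1)) (fun q hq => ?_)
    (fun q hq q' hq' h => padicValNat_injOn (w := r * n + i) ?_ ?_ h)
  · simp only [Finset.coe_filter, Finset.mem_univ, true_and, Set.mem_ofPred_eq] at hq
    obtain ⟨hq, s, hs, j, hj, hτ⟩ := hq
    obtain ⟨m, h1, h2⟩ := div_of_mem_nodeInterval (Nat.add_one_pos _) hq
    have hv : padicValNat 2 (q + 1) = j := by rw [hτ, padicValNat_node hj]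
    simp only [Finset.coe_filter, Finset.mem_range, Set.mem_ofPred_eq]
    refine ⟨padicValNat_lt_levels q, by omega, s, ?_, hs, ?_⟩
    · rw [nodeInterval, Finset.mem_Ioc] at hq
      have h3 := Nat.div_mul_le_self (s * n + n) (2 ^ j)
      by_contra! hlt
      have : (s + 1) * n ≤ r * n := Nat.mul_le_mul_right _ hlt
      rw [Nat.add_mul] at this
      omega
    · rw [h2, hv]
      rw [hv, hτ] at h1
      exact Nat.eq_of_mul_eq_mul_right (by positivity) h1
  · simp only [Finset.coe_filter, Finset.mem_univ, true_and, Set.mem_ofPred_eq] at hq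
    exact hq.1
  · simp only [Finset.coe_filter, Finset.mem_univ, true_and, Set.mem_ofPred_eq] at hq'
    exact hq'.1

theorem nodeSum_abs_le {n i T : ℕ} (hi : i < n) {δ : ℕ → ℝ}
    (hδ : ∀ u, (∀ r < T, u ≠ r * n + i + 1) → δ u = 0) (τ : ℕ) :
    |nodeSum δ τ| ≤ ∑ r ∈ Finset.range T,
      if r * n + i + 1 ∈ nodeInterval τ then |δ (r * n + i + 1)| else 0 := by
  refine (Finset.abs_sum_le_sum_abs _ _).trans (le_of_eq ?_)
  rw [← Finset.sum_filter,
    ← Finset.sum_image (f := fun u => |δ u|) (g := fun r => r * n + i + 1) (fun r _ r' _ h => by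
      have : r * n = r' * n := by simp only at h; omega
      exact Nat.eq_of_mul_eq_mul_right (by omega) this)]
  symm
  refine Finset.sum_subset (fun u hu => ?_) (fun u hu hu' => ?_)
  · obtain ⟨r, hr, rfl⟩ := Finset.mem_image.1 hu
    exact (Finset.mem_filter.1 hr).2
  · rw [hδ u, abs_zero]
    rintro r hr rfl
    exact hu' (Finset.mem_image.2 ⟨r, Finset.mem_filter.2 ⟨Finset.mem_range.2 hr, hu⟩, rfl⟩)

open Classical in
/-- The partial sums in which the noise is seen: all those of the counters of bids, and the observed
ones of the counter of unsatisfied bidders. -/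
def nodeShift {k N : ℕ} (n T : ℕ) (σ : Option (Fin k) → ℕ → ℝ) (q : Option (Fin k) × Fin N) : ℝ :=
  if q.1 = none ∧ ¬ Observed n T (q.2 + 1) then 0 else nodeSum (σ q.1) (q.2 + 1)

theorem sum_abs_nodeShift_le {n i T k : ℕ} (hi : i < n) (hT : 10 ≤ T)
    {δ : Option (Fin k) → ℕ → ℝ}
    (hδ : ∀ c u, (∀ r < T, u ≠ r * n + i + 1) → δ c u = 0)
    (h2 : ∀ u, ∑ j, |δ (some j) u| ≤ 2) (h1 : ∀ u, |δ none u| ≤ 1) :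
    ∑ q : Option (Fin k) × Fin (n * T), |nodeShift n T δ q| ≤ 2 * T * levels (n * T) := by
  classical
  rw [Fintype.sum_prod_type, Fintype.sum_option]
  set N := n * T with hN
  have hbid : ∑ j : Fin k, ∑ q : Fin N, |nodeShift n T δ (some j, q)| ≤
      ∑ r ∈ Finset.range T, 2 *
        ((Finset.univ.filter fun q : Fin N => r * n + i + 1 ∈ nodeInterval (q + 1)).card : ℝ) := by
    calc ∑ j : Fin k, ∑ q : Fin N, |nodeShift n T δ (some j, q)|
        ≤ ∑ j : Fin k, ∑ q : Fin N, ∑ r ∈ Finset.range T,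
          if r * n + i + 1 ∈ nodeInterval (q + 1) then |δ (some j) (r * n + i + 1)| else 0 := by
          refine Finset.sum_le_sum fun j _ => Finset.sum_le_sum fun q _ => ?_
          rw [nodeShift, if_neg (by simp)]
          exact nodeSum_abs_le hi (hδ _) _
      _ = ∑ r ∈ Finset.range T, ∑ q : Fin N,
          if r * n + i + 1 ∈ nodeInterval (q + 1) then ∑ j, |δ (some j) (r * n + i + 1)|
            else 0 := by
          rw [Finset.sum_comm]
          simp_rw [Finset.sum_comm (s := (Finset.univ : Finset (Fin k)))]
          rw [Finset.sum_comm]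
          refine Finset.sum_congr rfl fun r _ => Finset.sum_congr rfl fun q _ => ?_
          split_ifs <;> simp
      _ ≤ _ := by
          refine Finset.sum_le_sum fun r _ => ?_
          rw [Finset.card_filter, Nat.cast_sum, Finset.mul_sum]
          refine Finset.sum_le_sum fun q _ => ?_
          split_ifs
          · simpa using h2 _
          · simp
  have hrep : ∑ q : Fin N, |nodeShift n T δ (none, q)| ≤
      ∑ r ∈ Finset.range T, ((Finset.univ.filter fun q : Fin N =>
        r * n + i + 1 ∈ nodeInterval (q + 1) ∧ Observed n T (q + 1)).card : ℝ) := by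
    simp_rw [Finset.card_filter, Nat.cast_sum]
    rw [Finset.sum_comm]
    refine Finset.sum_le_sum fun q _ => ?_
    rw [nodeShift]
    by_cases ho : Observed n T (q + 1)
    · rw [if_neg (by tauto)]
      refine (nodeSum_abs_le hi (hδ _) _).trans (Finset.sum_le_sum fun r _ => ?_)
      by_cases hr : r * n + i + 1 ∈ nodeInterval (q + 1)
      · simpa [hr, ho] using h1 _
      · simp [hr]
    · rw [if_pos ⟨rfl, ho⟩, abs_zero]
      positivity
  refine (add_le_add hrep hbid).trans ?_
  have c1 : ∀ r, _ := fun r => card_observed_nodes_le (n := n) (i := i) (T := T) r N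
  have c2 : ∀ r, _ := fun r => card_nodes_add_card_ones_le (r * n + i) N
  have c3 := DyadicCount.sum_card_splits_le hi hT
  rw [← hN] at c3
  have c4 := Finset.sum_le_sum fun r (_ : r ∈ Finset.range T) => c1 r
  have c5 := Finset.sum_le_sum fun r (_ : r ∈ Finset.range T) => c2 r
  rw [Finset.sum_add_distrib, Finset.sum_const, Finset.card_range, smul_eq_mul] at c5
  rw [← Finset.mul_sum]
  -- Twice the digits `1` saved in the bid counters pays for the observed nodes of the reports.
  have c6 : ∑ r ∈ Finset.range T, (Finset.univ.filter fun q : Fin N =>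
        r * n + i + 1 ∈ nodeInterval (q + 1) ∧ Observed n T (q + 1)).card +
      2 * ∑ r ∈ Finset.range T, (Finset.univ.filter fun q : Fin N =>
        r * n + i + 1 ∈ nodeInterval (q + 1)).card ≤ 2 * T * levels N := by
    linarith
  exact_mod_cast c6

/-! ### The auction with general counters -/

/-- The fold over the first `m` elements of `Fin n`. -/
def foldUpTo {β : Type*} {n : ℕ} (f : β → Fin n → β) (a : β) : ℕ → β
  | 0 => a
  | m + 1 => if h : m < n then f (foldUpTo f a m) ⟨m, h⟩ else foldUpTo f a m

theorem foldl_finRange_eq_foldUpTo {β : Type*} {n : ℕ} (f : β → Fin n → β) (a : β) :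
    (List.finRange n).foldl f a = foldUpTo f a n := by
  have key : ∀ m ≤ n, ((List.finRange n).take m).foldl f a = foldUpTo f a m := by
    intro m hm
    induction m with
    | zero => simp [foldUpTo]
    | succ m ih =>
      have h : m < (List.finRange n).length := by simp; omega
      rw [List.take_succ_eq_append_getElem h, List.foldl_append, ih (by omega), foldUpTo,
        dif_pos (by omega)]
      simp
  have := key n le_rfl
  rwa [List.take_of_length_le (by simp)] at this

/-- All streams fed to the counters so far. -/
def State.stream {G : Type*} {n k : ℕ} (st : State G n k) : Option (Fin k) → ℕ → ℝ
  | none => st.reports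
  | some j => st.bids j

/-- A way to read the counters: a function of the counter, its stream and the time. -/
abbrev Reader (k : ℕ) : Type := Option (Fin k) → (ℕ → ℝ) → ℕ → ℝ

namespace Auction

set_option linter.unusedSectionVars false

variable {G : Type*} [Fintype G] [DecidableEq G] {n k : ℕ} (P : Auction G n k)

/-- The readings of the binary mechanisms with noise `ω`. -/
def noisyReader (ω : P.Seed) : Reader k := fun c σ t => binaryMechanism σ (P.noise ω c) t

/-- The readings when `y` holds the noisy partial sums. -/
def nodeReader (y : P.Seed) : Reader k := fun c _ t => sumNodes (P.noise y c) t

/-- The initial state. -/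
def initialState : State G n k :=
  { held := fun _ => ∅
    saved := fun _ _ => 0
    paid := fun _ _ => 0
    ticks := fun _ => 0
    count := fun _ => 0
    bids := fun _ _ => 0
    reports := fun _ => 0
    unsatisfied := 0
    halted := false }

/-- The answer of bidder `i` at her turn, if she keeps `held`, paid the prices `paid` and the
current prices are `ticks`: her bid and the state with her data updated. -/
def respondAt (choose : Choice G n k) (v : Finset G → ℝ) (r : ℕ) (i : Fin n)
    (d : Finset G × (G → ℕ) × (Fin k → ℕ)) (st : State G n k) : (Fin k → ℝ) × State G n k :=
  open Classical in
  let q := choose i v r d.1 d.2.1 d.2.2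
  if d.1 ⊂ Finset.univ ∧
      v d.1 - P.cost d.2.1 d.1 ≤ P.effectiveUtility v d.1 d.2.1 d.2.2 q.1 then
    (Pi.single (P.type q.2) 1,
      { st with
        held := Function.update st.held i (insert q.2 d.1)
        saved := Function.update st.saved i
          (Function.update (st.saved i) q.2 (st.count (P.type q.2)))
        paid := Function.update st.paid i
          (Function.update (st.paid i) q.2 (st.ticks (P.type q.2))) })
  else (0, { st with held := Function.update st.held i d.1 })

/-- The public and private data on which the decisions of bidder `i` depend. -/
def decisionData (st : State G n k) (i : Fin n) : Finset G × (G → ℕ) × (Fin k → ℕ) :=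
  (P.kept st i, st.paid i, st.ticks)

/-- The answer of bidder `i` at her turn: her bid and the state with her data updated. -/
def respond (choose : Choice G n k) (v : Finset G → ℝ) (r : ℕ) (i : Fin n)
    (st : State G n k) : (Fin k → ℝ) × State G n k :=
  P.respondAt choose v r i (P.decisionData st i) st

/-- `Auction.feedBids` with general counters. -/
def feedBidsWith (rd : Reader k) (t : ℕ) (b : Fin k → ℝ) (st : State G n k) : State G n k :=
  let bids : Fin k → ℕ → ℝ := fun j => Function.update (st.bids j) t (b j)
  let count : Fin k → ℝ := fun j => rd (some j) (bids j) t
  { st with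
    bids := bids
    count := count
    ticks := fun j =>
      if (st.ticks j + 1) * P.effectiveSupply ≤ count j then st.ticks j + 1 else st.ticks j }

/-- `Auction.turn` with general counters. -/
def turnWith (choose : Choice G n k) (v : Finset G → ℝ) (rd : Reader k) (r t : ℕ) (i : Fin n)
    (st : State G n k) : State G n k :=
  P.feedBidsWith rd t (P.respond choose v r i st).1 (P.respond choose v r i st).2

/-- The state after the turns of the first `m` bidders in round `r`. -/
def turnsWith (choose : Choice G n k) (v : Fin n → Finset G → ℝ) (rd : Reader k) (r : ℕ)
    (st : State G n k) (m : ℕ) : State G n k :=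
  foldUpTo (fun st i => P.turnWith choose (v i) rd r (r * n + i + 1) i st) st m

open Classical in
/-- The stream fed to the counter of unsatisfied bidders, after the reports of the first `m` bidders
in round `r`. -/
def reportsUpTo (v : Fin n → Finset G → ℝ) (r : ℕ) (st : State G n k) (m : ℕ) : ℕ → ℝ :=
  foldUpTo (fun σ (i : Fin n) =>
    Function.update σ (r * n + i + 1) (if P.Wants (v i) st i then 1 else 0)) st.reports m

open Classical in
/-- `Auction.countUnsatisfied` with general counters. -/
def countUnsatisfiedWith (v : Fin n → Finset G → ℝ) (rd : Reader k) (r : ℕ)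
    (st : State G n k) : State G n k :=
  let reading : ℝ := rd none (P.reportsUpTo v r st n) (r * n + n)
  { st with
    reports := P.reportsUpTo v r st n
    unsatisfied := reading
    halted := decide
      (reading - st.unsatisfied < P.ρ * Fintype.card G - 2 * P.errorBound) }

/-- `Auction.run` with general counters. -/
def runWith (choose : Choice G n k) (v : Fin n → Finset G → ℝ) (rd : Reader k) : ℕ → State G n k
  | 0 => initialState
  | r + 1 =>
    if (runWith choose v rd r).halted then runWith choose v rd r else
      P.countUnsatisfiedWith v rd r (P.turnsWith choose v rd r (runWith choose v rd r) n)

/-- `Auction.palloc` with general counters. -/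
def pallocWith (choose : Choice G n k) (D : Fin n → Valuation G P.type) (rd : Reader k) :
    Fin n → (Fin k → ℝ) × Finset G :=
  let st := P.runWith choose (fun i => (D i).val) rd P.rounds
  fun i => (fun j => P.α * st.ticks j, st.held i)

variable (choose : Choice G n k) (v v' : Fin n → Finset G → ℝ) (rd rd' : Reader k)

/-! ### The auction as an instance with general counters -/

theorem turn_eq (w : Finset G → ℝ) (ω : P.Seed) (r t : ℕ) (i : Fin n) (st : State G n k) :
    P.turn choose w ω r t i st = P.turnWith choose w (P.noisyReader ω) r t i st := by
  unfold turn turnWith respond respondAt decisionData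
  simp only
  split_ifs <;> rfl

theorem propose_eq (ω : P.Seed) (r : ℕ) (st : State G n k) :
    P.propose choose v ω r st = P.turnsWith choose v (P.noisyReader ω) r st n := by
  simp only [propose, turn_eq, foldl_finRange_eq_foldUpTo]
  rfl

theorem countUnsatisfied_eq (ω : P.Seed) (r : ℕ) (st : State G n k) :
    P.countUnsatisfied v ω r st = P.countUnsatisfiedWith v (P.noisyReader ω) r st := by
  simp only [countUnsatisfied, foldl_finRange_eq_foldUpTo]
  rfl

theorem run_eq (ω : P.Seed) (r : ℕ) :
    P.run choose v ω r = P.runWith choose v (P.noisyReader ω) r := by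
  induction r with
  | zero => rfl
  | succ r ih =>
    rw [run, runWith, ← ih, ← propose_eq, ← countUnsatisfied_eq]

theorem palloc_eq (D : Fin n → Valuation G P.type) (ω : P.Seed) :
    P.palloc choose D ω = P.pallocWith choose D (P.noisyReader ω) := by
  unfold palloc pallocWith
  rw [run_eq]

/-! #### The answers of the bidders -/

/-- A bid vector is zero or a bid on one type. -/
def IsBid (b : Fin k → ℝ) : Prop := b = 0 ∨ ∃ j, b = Pi.single j 1

variable {P choose}

section Respond

variable {w : Finset G → ℝ} {r : ℕ} {i : Fin n} {d : Finset G × (G → ℕ) × (Fin k → ℕ)}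
  {st : State G n k}

theorem respondAt_isBid : IsBid (P.respondAt choose w r i d st).1 := by
  unfold respondAt
  simp only
  split_ifs
  · exact Or.inr ⟨_, rfl⟩
  · exact Or.inl rfl

theorem respondAt_public : (P.respondAt choose w r i d st).2.ticks = st.ticks ∧
    (P.respondAt choose w r i d st).2.count = st.count ∧
    (P.respondAt choose w r i d st).2.bids = st.bids ∧
    (P.respondAt choose w r i d st).2.reports = st.reports ∧
    (P.respondAt choose w r i d st).2.unsatisfied = st.unsatisfied ∧
    (P.respondAt choose w r i d st).2.halted = st.halted := by
  unfold respondAt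
  simp only
  split_ifs <;> simp

theorem respondAt_of_ne {j : Fin n} (hj : j ≠ i) :
    (P.respondAt choose w r i d st).2.held j = st.held j ∧
    (P.respondAt choose w r i d st).2.saved j = st.saved j ∧
    (P.respondAt choose w r i d st).2.paid j = st.paid j := by
  unfold respondAt
  simp only
  split_ifs <;> simp [hj]

end Respond

section TurnStreams

variable {w : Finset G → ℝ} {rd} {r t : ℕ} {i : Fin n} {st : State G n k}

theorem turnWith_bids : (P.turnWith choose w rd r t i st).bids =
    fun j => Function.update (st.bids j) t ((P.respond choose w r i st).1 j) := by
  unfold turnWith feedBidsWith respond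
  simp only [respondAt_public]

theorem turnWith_reports : (P.turnWith choose w rd r t i st).reports = st.reports := by
  unfold turnWith feedBidsWith respond
  simp only [respondAt_public]

theorem turnWith_halted : (P.turnWith choose w rd r t i st).halted = st.halted := by
  unfold turnWith feedBidsWith respond
  simp only [respondAt_public]

theorem turnWith_unsatisfied : (P.turnWith choose w rd r t i st).unsatisfied = st.unsatisfied := by
  unfold turnWith feedBidsWith respond
  simp only [respondAt_public]

end TurnStreams

/-! #### The streams only change at the current times -/

variable {v v' rd rd'} {r m : ℕ} {st : State G n k}

theorem turnsWith_succ (h : m < n) : P.turnsWith choose v rd r st (m + 1) =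
    P.turnWith choose (v ⟨m, h⟩) rd r (r * n + m + 1) ⟨m, h⟩
      (P.turnsWith choose v rd r st m) := by
  rw [turnsWith, foldUpTo, dif_pos h]; rfl

theorem reportsUpTo_succ (h : m < n) : P.reportsUpTo v r st (m + 1) =
    open Classical in Function.update (P.reportsUpTo v r st m) (r * n + m + 1)
      (if P.Wants (v ⟨m, h⟩) st ⟨m, h⟩ then 1 else 0) := by
  rw [reportsUpTo, foldUpTo, dif_pos h]; rfl

theorem turnsWith_reports (hm : m ≤ n) :
    (P.turnsWith choose v rd r st m).reports = st.reports := by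
  induction m with
  | zero => rfl
  | succ m ih => rw [turnsWith_succ hm, turnWith_reports, ih (by omega)]

theorem turnsWith_bids_of_le {m' u : ℕ} (hm : m ≤ m') (hm' : m' ≤ n) (hu : u ≤ r * n + m)
    (j : Fin k) :
    (P.turnsWith choose v rd r st m').bids j u = (P.turnsWith choose v rd r st m).bids j u := by
  induction m', hm using Nat.le_induction with
  | base => rfl
  | succ m' h ih =>
    rw [turnsWith_succ hm', turnWith_bids, ← ih (by omega)]
    exact Function.update_of_ne (by omega) _ _

theorem reportsUpTo_of_le (hm : m ≤ n) {u : ℕ} (hu : u ≤ r * n) :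
    P.reportsUpTo v r st m u = st.reports u := by
  induction m with
  | zero => rfl
  | succ m ih => rw [reportsUpTo_succ hm, Function.update_of_ne (by omega), ih (by omega)]

theorem runWith_succ_of_halted (h : (P.runWith choose v rd r).halted = true) :
    P.runWith choose v rd (r + 1) = P.runWith choose v rd r := by
  rw [runWith, if_pos h]

theorem runWith_succ (h : (P.runWith choose v rd r).halted = false) :
    P.runWith choose v rd (r + 1) = P.countUnsatisfiedWith v rd r
      (P.turnsWith choose v rd r (P.runWith choose v rd r) n) := by
  rw [runWith, if_neg (by simp [h])]

theorem runWith_stream_succ {u : ℕ} (hu : u ≤ r * n) (c : Option (Fin k)) :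
    (P.runWith choose v rd (r + 1)).stream c u = (P.runWith choose v rd r).stream c u := by
  cases h : (P.runWith choose v rd r).halted
  · rw [runWith_succ h]
    cases c with
    | none =>
      change P.reportsUpTo v r _ n u = _
      rw [reportsUpTo_of_le le_rfl hu, turnsWith_reports le_rfl]
      rfl
    | some j => exact turnsWith_bids_of_le (Nat.zero_le n) le_rfl hu j
  · rw [runWith_succ_of_halted h]

theorem runWith_stream_of_le {r' u : ℕ} (h : r ≤ r') (hu : u ≤ r * n) (c : Option (Fin k)) :
    (P.runWith choose v rd r').stream c u = (P.runWith choose v rd r).stream c u := by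
  induction r', h using Nat.le_induction with
  | base => rfl
  | succ r' h ih => rw [runWith_stream_succ (hu.trans (Nat.mul_le_mul_right n h)), ih]

/-- The times at which the counters are read in the first `T` rounds. -/
def IsReadingTime (n T : ℕ) (c : Option (Fin k)) (t : ℕ) : Prop :=
  (∃ s < T, t = s * n + n) ∨ (c ≠ none ∧ t ≤ n * T)

/-- Two ways of reading the counters that agree on the final streams of one run yield the same
run. -/
theorem runWith_congr {T : ℕ}
    (h : ∀ c t σ, IsReadingTime n T c t →
      (∀ u ≤ t, σ u = (P.runWith choose v rd T).stream c u) → rd' c σ t = rd c σ t)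
    (hr : r ≤ T) : P.runWith choose v rd' r = P.runWith choose v rd r := by
  induction r with
  | zero => rfl
  | succ r ih =>
    have ih := ih (by omega)
    cases hh : (P.runWith choose v rd r).halted
    · have hfin : ∀ c u, u ≤ r * n + n → (P.runWith choose v rd T).stream c u =
          (P.runWith choose v rd (r + 1)).stream c u := fun c u hu =>
        runWith_stream_of_le hr (by rw [Nat.add_mul]; omega) c
      rw [runWith_succ (ih ▸ hh), ih]
      rw [runWith_succ hh] at hfin ⊢
      set st := P.runWith choose v rd r
      have hturns : ∀ m ≤ n, P.turnsWith choose v rd' r st m =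
          P.turnsWith choose v rd r st m := by
        intro m hm
        induction m with
        | zero => rfl
        | succ m ihm =>
          have hT : (r + 1) * n ≤ n * T := by
            rw [Nat.mul_comm n]; exact Nat.mul_le_mul_right n hr
          rw [Nat.add_mul] at hT
          have key : ∀ j : Fin k, rd' (some j) ((P.turnsWith choose v rd r st (m + 1)).bids j)
              (r * n + m + 1) = rd (some j) ((P.turnsWith choose v rd r st (m + 1)).bids j)
              (r * n + m + 1) := by
            intro j
            refine h _ _ _ (Or.inr ⟨by simp, by omega⟩) fun u hu => ?_
            rw [hfin _ _ (by omega)]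
            exact (turnsWith_bids_of_le hm le_rfl (by omega) j).symm
          rw [turnsWith_succ hm, turnWith_bids] at key
          rw [turnsWith_succ hm, turnsWith_succ hm, ihm (by omega)]
          unfold turnWith feedBidsWith respond
          unfold respond at key
          simp only [respondAt_public]
          simp only [key]
      rw [hturns n le_rfl]
      unfold countUnsatisfiedWith
      simp only
      have key : rd' none (P.reportsUpTo v r (P.turnsWith choose v rd r st n) n) (r * n + n) =
          rd none (P.reportsUpTo v r (P.turnsWith choose v rd r st n) n) (r * n + n) :=
        h none (r * n + n) _ (Or.inl ⟨r, by omega, rfl⟩) fun u hu => (hfin none u hu).symm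
      rw [key]
    · rw [runWith_succ_of_halted hh, runWith_succ_of_halted (ih ▸ hh), ih]

/-! #### The streams consist of bids -/

/-- Each entry of the streams is a bid or a report. -/
def BinaryStreams (st : State G n k) : Prop :=
  ∀ u, IsBid (fun j => st.bids j u) ∧ (st.reports u = 0 ∨ st.reports u = 1)

theorem binaryStreams_turnsWith (h : BinaryStreams st) (hm : m ≤ n) :
    BinaryStreams (P.turnsWith choose v rd r st m) := by
  intro u
  refine ⟨?_, by rw [turnsWith_reports hm]; exact (h u).2⟩
  induction m with
  | zero => exact (h u).1
  | succ m ih =>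
    rw [turnsWith_succ hm, turnWith_bids]
    by_cases hu : u = r * n + m + 1
    · subst hu
      simp only [Function.update_self]
      exact respondAt_isBid
    · simp only [Function.update_of_ne hu]
      exact ih (by omega)

theorem binaryStreams_runWith : BinaryStreams (P.runWith choose v rd r) := by
  induction r with
  | zero => exact fun u => ⟨Or.inl rfl, Or.inl rfl⟩
  | succ r ih =>
    cases hh : (P.runWith choose v rd r).halted
    · rw [runWith_succ hh]
      have h := binaryStreams_turnsWith (P := P) (choose := choose) (v := v) (rd := rd) (r := r) ih le_rfl
      refine fun u => ⟨(h u).1, ?_⟩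
      set st := P.turnsWith choose v rd r (P.runWith choose v rd r) n
      have key : ∀ m ≤ n, P.reportsUpTo v r st m u = 0 ∨ P.reportsUpTo v r st m u = 1 := by
        intro m hm
        induction m with
        | zero => exact (h u).2
        | succ m ihm =>
          rw [reportsUpTo_succ hm]
          by_cases hu : u = r * n + m + 1
          · subst hu
            rw [Function.update_self]
            split_ifs <;> simp
          · rw [Function.update_of_ne hu]
            exact ihm (by omega)
      exact key n le_rfl
    · rwa [runWith_succ_of_halted hh]

/-! #### Runs with databases that differ in one entry -/

/-- Two states agree on all public data and on the data of the bidders other than `i`, and their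
streams agree outside the times of bidder `i` in the first `T` rounds. -/
structure AgreeOff (T : ℕ) (i : Fin n) (st st' : State G n k) : Prop where
  held : ∀ j, j ≠ i → st.held j = st'.held j
  saved : ∀ j, j ≠ i → st.saved j = st'.saved j
  paid : ∀ j, j ≠ i → st.paid j = st'.paid j
  ticks : st.ticks = st'.ticks
  count : st.count = st'.count
  unsatisfied : st.unsatisfied = st'.unsatisfied
  halted : st.halted = st'.halted
  bids : ∀ j u, (∀ r < T, u ≠ r * n + i + 1) → st.bids j u = st'.bids j u
  reports : ∀ u, (∀ r < T, u ≠ r * n + i + 1) → st.reports u = st'.reports u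

section AgreeOff

variable {T : ℕ} {i : Fin n} {st' : State G n k}

theorem AgreeOff.decisionData_eq (h : AgreeOff T i st st') {j : Fin n} (hj : j ≠ i) :
    P.decisionData st j = P.decisionData st' j := by
  unfold decisionData kept
  rw [h.held j hj, h.saved j hj, h.paid j hj, h.count, h.ticks]

/-- The readings ignore the streams, so whatever bidder `i` does has no effect on the public data;
any other bidder sees equal data and acts equally. -/
theorem AgreeOff.turnWith (hrd : ∀ c σ σ' t, rd c σ t = rd c σ' t)
    (hv : ∀ j, j ≠ i → v j = v' j) (h : AgreeOff T i st st') (hr : r < T) (j : Fin n) :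
    AgreeOff T i (P.turnWith choose (v j) rd r (r * n + j + 1) j st)
      (P.turnWith choose (v' j) rd r (r * n + j + 1) j st') := by
  have hcount : ∀ b b' : Fin k → ℝ, ∀ s s' : State G n k,
      (P.feedBidsWith rd (r * n + j + 1) b s).count =
        (P.feedBidsWith rd (r * n + j + 1) b' s').count := fun b b' s s' =>
    funext fun c => hrd _ _ _ _
  have hticks : ∀ b b' : Fin k → ℝ, ∀ s s' : State G n k, s.ticks = s'.ticks →
      (P.feedBidsWith rd (r * n + j + 1) b s).ticks =
        (P.feedBidsWith rd (r * n + j + 1) b' s').ticks := by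
    intro b b' s s' hs
    funext c
    unfold feedBidsWith
    simp only [hs, hrd (some c) (Function.update (s.bids c) _ _)
      (Function.update (s'.bids c) (r * n + j + 1) (b' c))]
  have hbids : ∀ c u, (∀ r < T, u ≠ r * n + i + 1) →
      (P.turnWith choose (v j) rd r (r * n + j + 1) j st).bids c u =
      (P.turnWith choose (v' j) rd r (r * n + j + 1) j st').bids c u := by
    intro c u hu
    simp only [turnWith_bids]
    by_cases hj : j = i
    · subst hj
      rw [Function.update_of_ne (hu r hr), Function.update_of_ne (hu r hr), h.bids c u hu]
    · by_cases hu' : u = r * n + j + 1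
      · subst hu'
        rw [Function.update_self, Function.update_self, respond, respond, h.decisionData_eq hj,
          hv j hj]
        unfold respondAt
        simp only
        split_ifs <;> rfl
      · rw [Function.update_of_ne hu', Function.update_of_ne hu', h.bids c u hu]
  have hself : j ≠ i → (P.respond choose (v j) r j st).2.held j =
        (P.respond choose (v' j) r j st').2.held j ∧
      (P.respond choose (v j) r j st).2.saved j = (P.respond choose (v' j) r j st').2.saved j ∧
      (P.respond choose (v j) r j st).2.paid j = (P.respond choose (v' j) r j st').2.paid j := by
    intro hj
    rw [respond, respond, h.decisionData_eq hj, hv j hj]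
    unfold respondAt
    simp only
    split_ifs
    · simp [h.saved j hj, h.paid j hj, h.count, h.ticks]
    · simp [h.saved j hj, h.paid j hj]
  have hpriv : ∀ l, l ≠ i → (P.respond choose (v j) r j st).2.held l =
        (P.respond choose (v' j) r j st').2.held l ∧
      (P.respond choose (v j) r j st).2.saved l = (P.respond choose (v' j) r j st').2.saved l ∧
      (P.respond choose (v j) r j st).2.paid l = (P.respond choose (v' j) r j st').2.paid l := by
    intro l hl
    by_cases hlj : l = j
    · subst hlj; exact hself hl
    · unfold respond
      simp only [respondAt_of_ne hlj, h.held l hl, h.saved l hl, h.paid l hl, and_self]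
  exact
    { held := fun l hl => (hpriv l hl).1
      saved := fun l hl => (hpriv l hl).2.1
      paid := fun l hl => (hpriv l hl).2.2
      ticks := hticks _ _ _ _ (by
        unfold respond; rw [respondAt_public.1, respondAt_public.1, h.ticks])
      count := hcount _ _ _ _
      unsatisfied := by rw [turnWith_unsatisfied, turnWith_unsatisfied, h.unsatisfied]
      halted := by rw [turnWith_halted, turnWith_halted, h.halted]
      bids := hbids
      reports := by rw [turnWith_reports, turnWith_reports]; exact h.reports }

theorem AgreeOff.turnsWith (hrd : ∀ c σ σ' t, rd c σ t = rd c σ' t)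
    (hv : ∀ j, j ≠ i → v j = v' j) (h : AgreeOff T i st st') (hr : r < T) (hm : m ≤ n) :
    AgreeOff T i (P.turnsWith choose v rd r st m) (P.turnsWith choose v' rd r st' m) := by
  induction m with
  | zero => exact h
  | succ m ih =>
    rw [turnsWith_succ hm, turnsWith_succ hm]
    exact (ih (by omega)).turnWith hrd hv hr ⟨m, hm⟩

theorem AgreeOff.wants_iff (h : AgreeOff T i st st') {j : Fin n} (hj : j ≠ i)
    (w : Finset G → ℝ) : P.Wants w st j ↔ P.Wants w st' j := by
  have h1 : P.kept st j = P.kept st' j := congrArg Prod.fst (h.decisionData_eq (P := P) hj)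
  unfold Wants
  rw [h1, h.paid j hj, h.ticks]

theorem AgreeOff.countUnsatisfiedWith (hrd : ∀ c σ σ' t, rd c σ t = rd c σ' t)
    (hv : ∀ j, j ≠ i → v j = v' j) (h : AgreeOff T i st st') (hr : r < T) :
    AgreeOff T i (P.countUnsatisfiedWith v rd r st) (P.countUnsatisfiedWith v' rd r st') := by
  have hrep : ∀ u, (∀ r < T, u ≠ r * n + i + 1) → ∀ m ≤ n,
      P.reportsUpTo v r st m u = P.reportsUpTo v' r st' m u := by
    intro u hu m hm
    induction m with
    | zero => exact h.reports u hu
    | succ m ih =>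
      rw [reportsUpTo_succ hm, reportsUpTo_succ hm]
      by_cases hu' : u = r * n + m + 1
      · have hj : (⟨m, hm⟩ : Fin n) ≠ i := by
          rintro rfl
          exact hu r hr hu'
        subst hu'
        rw [Function.update_self, Function.update_self, hv _ hj]
        classical exact if_congr (h.wants_iff hj _) rfl rfl
      · rw [Function.update_of_ne hu', Function.update_of_ne hu', ih (by omega)]
  have hread : rd none (P.reportsUpTo v r st n) (r * n + n) =
      rd none (P.reportsUpTo v' r st' n) (r * n + n) := hrd _ _ _ _
  exact
    { held := h.held
      saved := h.saved
      paid := h.paid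
      ticks := h.ticks
      count := h.count
      unsatisfied := hread
      halted := by
        unfold Auction.countUnsatisfiedWith
        simp only [hread, h.unsatisfied]
      bids := h.bids
      reports := fun u hu => hrep u hu n le_rfl }

theorem agreeOff_runWith (hrd : ∀ c σ σ' t, rd c σ t = rd c σ' t)
    (hv : ∀ j, j ≠ i → v j = v' j) (hr : r ≤ T) :
    AgreeOff T i (P.runWith choose v rd r) (P.runWith choose v' rd r) := by
  induction r with
  | zero => constructor <;> intros <;> rfl
  | succ r ih =>
    have ih := ih (by omega)
    cases hh : (P.runWith choose v rd r).halted
    · rw [runWith_succ hh, runWith_succ (ih.halted ▸ hh)]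
      exact (ih.turnsWith hrd hv hr le_rfl).countUnsatisfiedWith hrd hv hr
    · rwa [runWith_succ_of_halted hh, runWith_succ_of_halted (ih.halted ▸ hh)]

end AgreeOff

end Auction

/-! ### Measurability of the auction -/

/-- This allows an arbitrary, possibly irregular, dependence on a discrete variable, such as that of
the choice rule on its data: freeze the variable and glue countably many pieces. -/
theorem measurable_of_countable_fibers {Ω κ β : Type*} [MeasurableSpace Ω] [Countable κ]
    {mβ : MeasurableSpace β} {d : Ω → κ} (hd : ∀ c, MeasurableSet {ω | d ω = c})
    {f : κ → Ω → β} (hf : ∀ c, Measurable (f c)) : Measurable fun ω => f (d ω) ω := by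
  intro s hs
  have : (fun ω => f (d ω) ω) ⁻¹' s = ⋃ c, {ω | d ω = c} ∩ f c ⁻¹' s := by
    ext ω; simp
  rw [this]
  exact MeasurableSet.iUnion fun c => (hd c).inter (hf c hs)

theorem measurableSet_of_countable_fibers {Ω κ : Type*} [MeasurableSpace Ω] [Countable κ]
    {d : Ω → κ} (hd : ∀ c, MeasurableSet {ω | d ω = c}) (p : κ → Prop) :
    MeasurableSet {ω | p (d ω)} :=
  measurableSet_setOfPred.2
    (measurable_of_countable_fibers (f := fun c _ => p c) hd fun _ => measurable_const)

namespace Auction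

set_option linter.unusedSectionVars false

variable {G : Type*} [Fintype G] [DecidableEq G] {n k : ℕ}

/-- A random state all of whose components are measurable. -/
structure MeasurableState {Ω : Type*} [MeasurableSpace Ω] (st : Ω → State G n k) : Prop where
  held : ∀ i, Measurable[_, ⊤] fun ω => (st ω).held i
  saved : ∀ i g, Measurable fun ω => (st ω).saved i g
  paid : ∀ i g, Measurable fun ω => (st ω).paid i g
  ticks : ∀ j, Measurable fun ω => (st ω).ticks j
  count : ∀ j, Measurable fun ω => (st ω).count j
  bids : ∀ j u, Measurable fun ω => (st ω).bids j u
  reports : ∀ u, Measurable fun ω => (st ω).reports u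
  unsatisfied : Measurable fun ω => (st ω).unsatisfied
  halted : Measurable fun ω => (st ω).halted

/-- Random counters whose readings are measurable. -/
def MeasurableReader {Ω : Type*} [MeasurableSpace Ω] (rd : Ω → Reader k) : Prop :=
  ∀ c t (σ : Ω → ℕ → ℝ), (∀ u, Measurable fun ω => σ ω u) → Measurable fun ω => rd ω c (σ ω) t

variable {Ω : Type*} [MeasurableSpace Ω] {st : Ω → State G n k} {P : Auction G n k}
  {choose : Choice G n k} {rd : Ω → Reader k} {v : Fin n → Finset G → ℝ} {r : ℕ}

theorem measurableState_of_countable_fibers {κ : Type*} [Countable κ] {d : Ω → κ}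
    (hd : ∀ c, MeasurableSet {ω | d ω = c}) {f : κ → Ω → State G n k}
    (hf : ∀ c, MeasurableState (f c)) : MeasurableState fun ω => f (d ω) ω :=
  { held := fun i => measurable_of_countable_fibers hd fun c => (hf c).held i
    saved := fun i g => measurable_of_countable_fibers hd fun c => (hf c).saved i g
    paid := fun i g => measurable_of_countable_fibers hd fun c => (hf c).paid i g
    ticks := fun j => measurable_of_countable_fibers hd fun c => (hf c).ticks j
    count := fun j => measurable_of_countable_fibers hd fun c => (hf c).count j
    bids := fun j u => measurable_of_countable_fibers hd fun c => (hf c).bids j u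
    reports := fun u => measurable_of_countable_fibers hd fun c => (hf c).reports u
    unsatisfied := measurable_of_countable_fibers hd fun c => (hf c).unsatisfied
    halted := measurable_of_countable_fibers hd fun c => (hf c).halted }

theorem MeasurableState.held_eq (h : MeasurableState st) (i : Fin n) (S : Finset G) :
    MeasurableSet {ω | (st ω).held i = S} :=
  h.held i (MeasurableSpace.measurableSet_top (s := {S}))

theorem MeasurableState.kept_eq (h : MeasurableState st) (i : Fin n) (S : Finset G) :
    MeasurableSet {ω | P.kept (st ω) i = S} := by
  have e : {ω | P.kept (st ω) i = S} = {ω | ∀ g, (g ∈ (st ω).held i ∧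
      (st ω).count (P.type g) - (st ω).saved i g < P.effectiveSupply) ↔ g ∈ S} := by
    ext ω
    simp [Finset.ext_iff, kept]
  rw [e]
  have h1 : ∀ g, MeasurableSet {ω | g ∈ (st ω).held i} := fun g =>
    h.held i (MeasurableSpace.measurableSet_top (s := {S | g ∈ S}))
  have h2 : ∀ g, MeasurableSet {ω |
      (st ω).count (P.type g) - (st ω).saved i g < P.effectiveSupply} := fun g =>
    measurableSet_lt ((h.count _).sub (h.saved _ _)) measurable_const
  simp only [measurableSet_setOfPred] at h1 h2 ⊢
  exact Measurable.forall fun g => ((h1 g).and (h2 g)).iff measurable_const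

theorem MeasurableState.decisionData_eq (h : MeasurableState st) (i : Fin n)
    (d : Finset G × (G → ℕ) × (Fin k → ℕ)) :
    MeasurableSet {ω | P.decisionData (st ω) i = d} := by
  have e : {ω | P.decisionData (st ω) i = d} = {ω | P.kept (st ω) i = d.1} ∩
      ({ω | (st ω).paid i = d.2.1} ∩ {ω | (st ω).ticks = d.2.2}) := by
    ext ω
    simp [decisionData, Prod.ext_iff]
  rw [e]
  refine (h.kept_eq i _).inter (MeasurableSet.inter ?_ ?_)
  · exact (measurable_pi_iff.2 (h.paid i)) (measurableSet_singleton d.2.1)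
  · exact (measurable_pi_iff.2 h.ticks) (measurableSet_singleton d.2.2)

theorem MeasurableState.respondAt (h : MeasurableState st) (w : Finset G → ℝ) (i : Fin n)
    (d : Finset G × (G → ℕ) × (Fin k → ℕ)) :
    MeasurableState fun ω => (P.respondAt choose w r i d (st ω)).2 := by
  have hheld : ∀ S j, Measurable[_, ⊤] fun ω => Function.update (st ω).held i S j := by
    intro S j
    by_cases hj : j = i
    · subst hj; simp only [Function.update_self]; exact @measurable_const _ _ ⊤ _ _
    · simp only [Function.update_of_ne hj]; exact h.held j
  unfold Auction.respondAt
  simp only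
  split_ifs
  · refine ⟨hheld _, fun j g => ?_, fun j g => ?_, h.ticks, h.count, h.bids, h.reports,
      h.unsatisfied, h.halted⟩
    · by_cases hj : j = i
      · subst hj
        simp only [Function.update_self]
        by_cases hg : g = (choose j w r d.1 d.2.1 d.2.2).2
        · subst hg; simp only [Function.update_self]; exact h.count _
        · simp only [Function.update_of_ne hg]; exact h.saved j g
      · simp only [Function.update_of_ne hj]; exact h.saved j g
    · by_cases hj : j = i
      · subst hj
        simp only [Function.update_self]
        by_cases hg : g = (choose j w r d.1 d.2.1 d.2.2).2
        · subst hg; simp only [Function.update_self]; exact h.ticks _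
        · simp only [Function.update_of_ne hg]; exact h.paid j g
      · simp only [Function.update_of_ne hj]; exact h.paid j g
  · exact ⟨hheld _, h.saved, h.paid, h.ticks, h.count, h.bids, h.reports,
      h.unsatisfied, h.halted⟩

theorem MeasurableState.feedBidsWith (h : MeasurableState st) (hrd : MeasurableReader rd) (t : ℕ)
    (b : Fin k → ℝ) : MeasurableState fun ω => P.feedBidsWith (rd ω) t b (st ω) := by
  have hb : ∀ j u, Measurable fun ω => Function.update ((st ω).bids j) t (b j) u := by
    intro j u
    by_cases hu : u = t
    · subst hu; simp only [Function.update_self]; exact measurable_const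
    · simp only [Function.update_of_ne hu]; exact h.bids j u
  have hc : ∀ j, Measurable fun ω =>
      rd ω (some j) (Function.update ((st ω).bids j) t (b j)) t := fun j => hrd _ _ _ (hb j)
  refine ⟨h.held, h.saved, h.paid, fun j => ?_, hc, hb, h.reports, h.unsatisfied, h.halted⟩
  have ht : Measurable fun ω => ((st ω).ticks j : ℝ) := measurable_from_top.comp (h.ticks j)
  have ht' : Measurable fun ω => (st ω).ticks j + 1 := (h.ticks j).add measurable_const
  exact Measurable.ite (measurableSet_le ((ht.add_const 1).mul_const _) (hc j)) ht' (h.ticks j)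

theorem respondAt_fst_eq (w : Finset G → ℝ) (i : Fin n) (d : Finset G × (G → ℕ) × (Fin k → ℕ))
    (s s' : State G n k) :
    (P.respondAt choose w r i d s).1 = (P.respondAt choose w r i d s').1 := by
  unfold Auction.respondAt
  simp only
  split_ifs <;> rfl

theorem MeasurableState.turnWith (h : MeasurableState st) (hrd : MeasurableReader rd)
    (w : Finset G → ℝ) (t : ℕ) (i : Fin n) :
    MeasurableState fun ω => P.turnWith choose w (rd ω) r t i (st ω) := by
  refine measurableState_of_countable_fibers (f := fun d ω => P.feedBidsWith (rd ω) t
    (P.respondAt choose w r i d (st ω)).1 (P.respondAt choose w r i d (st ω)).2)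
    (h.decisionData_eq (P := P) i) fun d => ?_
  -- Once `d` is frozen, the bid does not depend on the state, so any fixed state makes it constant
  -- in the noise.
  simp only [respondAt_fst_eq w i d _ initialState]
  exact (h.respondAt w i d).feedBidsWith hrd t _

theorem MeasurableState.turnsWith (h : MeasurableState st) (hrd : MeasurableReader rd) {m : ℕ}
    (hm : m ≤ n) : MeasurableState fun ω => P.turnsWith choose v (rd ω) r (st ω) m := by
  induction m with
  | zero => exact h
  | succ m ih =>
    simp only [turnsWith_succ hm]
    exact (ih (by omega)).turnWith hrd _ _ _

theorem MeasurableState.wants (h : MeasurableState st) (w : Finset G → ℝ) (i : Fin n) :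
    MeasurableSet {ω | P.Wants w (st ω) i} :=
  measurableSet_of_countable_fibers (h.decisionData_eq (P := P) i)
    fun d => ∃ W, d.1 ⊂ W ∧ w d.1 - P.cost d.2.1 d.1 ≤ P.effectiveUtility w d.1 d.2.1 d.2.2 W

theorem MeasurableState.countUnsatisfiedWith (h : MeasurableState st) (hrd : MeasurableReader rd) :
    MeasurableState fun ω => P.countUnsatisfiedWith v (rd ω) r (st ω) := by
  have hrep : ∀ m ≤ n, ∀ u, Measurable fun ω => P.reportsUpTo v r (st ω) m u := by
    intro m hm u
    induction m with
    | zero => exact h.reports u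
    | succ m ih =>
      simp only [reportsUpTo_succ hm]
      by_cases hu : u = r * n + m + 1
      · subst hu
        simp only [Function.update_self]
        exact Measurable.ite (h.wants _ _) measurable_const measurable_const
      · simp only [Function.update_of_ne hu]
        exact ih (by omega)
  have hread : Measurable fun ω => rd ω none (P.reportsUpTo v r (st ω) n) (r * n + n) :=
    hrd _ _ _ (hrep n le_rfl)
  refine ⟨h.held, h.saved, h.paid, h.ticks, h.count, h.bids, hrep n le_rfl, hread, ?_⟩
  refine measurable_to_bool ?_
  have e : (fun ω => (P.countUnsatisfiedWith v (rd ω) r (st ω)).halted) ⁻¹' {true} =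
      {ω | rd ω none (P.reportsUpTo v r (st ω) n) (r * n + n) - (st ω).unsatisfied <
        P.ρ * Fintype.card G - 2 * P.errorBound} := by
    ext ω
    simp [Auction.countUnsatisfiedWith]
  rw [e]
  exact measurableSet_lt (hread.sub h.unsatisfied) measurable_const

theorem measurableState_runWith (hrd : MeasurableReader rd) :
    MeasurableState fun ω => P.runWith choose v (rd ω) r := by
  induction r with
  | zero =>
    constructor <;> intros
    · exact @measurable_const _ _ ⊤ _ _
    all_goals exact measurable_const
  | succ r ih =>
    have h1 := (ih.turnsWith (P := P) (choose := choose) (v := v) (r := r) hrd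
      le_rfl).countUnsatisfiedWith (P := P) (v := v) (r := r) hrd
    refine measurableState_of_countable_fibers (d := fun ω => (P.runWith choose v (rd ω) r).halted)
      (f := fun b ω => if b then P.runWith choose v (rd ω) r else P.countUnsatisfiedWith v (rd ω) r
        (P.turnsWith choose v (rd ω) r (P.runWith choose v (rd ω) r) n))
      (fun c => ih.halted (measurableSet_singleton c)) fun b => ?_
    cases b
    · simpa using h1
    · simpa using ih

/-- The output is a function of bundles and price ticks, which take countably many values; hence `S`
need not be measurable. -/
theorem measurableSet_pallocWith (hrd : MeasurableReader rd) (D : Fin n → Valuation G P.type)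
    (S : Set (Fin n → (Fin k → ℝ) × Finset G)) :
    MeasurableSet {ω | P.pallocWith choose D (rd ω) ∈ S} := by
  have h := measurableState_runWith (P := P) (choose := choose) (v := fun i => (D i).val)
    (r := P.rounds) hrd
  refine measurableSet_of_countable_fibers (d := fun ω =>
    ((P.runWith choose (fun i => (D i).val) (rd ω) P.rounds).held,
      (P.runWith choose (fun i => (D i).val) (rd ω) P.rounds).ticks)) (fun c => ?_)
    fun d => (fun i => (fun j => P.α * d.2 j, d.1 i)) ∈ S
  have e : {ω | ((P.runWith choose (fun i => (D i).val) (rd ω) P.rounds).held,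
      (P.runWith choose (fun i => (D i).val) (rd ω) P.rounds).ticks) = c} =
      {ω | ∀ i, (P.runWith choose (fun i => (D i).val) (rd ω) P.rounds).held i = c.1 i} ∩
      {ω | (P.runWith choose (fun i => (D i).val) (rd ω) P.rounds).ticks = c.2} := by
    ext ω
    simp [Prod.ext_iff, funext_iff]
  rw [e]
  refine MeasurableSet.inter ?_ ((measurable_pi_iff.2 h.ticks) (measurableSet_singleton c.2))
  simp only [Set.ofPred_forall]
  exact MeasurableSet.iInter fun i => h.held_eq i _

variable (P)

/-! ### Measurability of the two readers -/

theorem measurable_noise (c : Option (Fin k)) (t : ℕ) : Measurable fun ω => P.noise ω c t := by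
  unfold noise
  split_ifs
  · exact measurable_pi_apply _
  · exact measurable_const

theorem measurableReader_noisyReader : MeasurableReader P.noisyReader := by
  intro c t σ hσ
  unfold noisyReader binaryMechanism
  exact Finset.measurable_fun_sum _ fun j _ =>
    (Finset.measurable_fun_sum _ fun u _ => hσ u).add (P.measurable_noise c _)

theorem measurableReader_nodeReader : MeasurableReader P.nodeReader := by
  intro c t σ _
  unfold nodeReader sumNodes
  exact Finset.measurable_fun_sum _ fun j _ => P.measurable_noise c _

/-! ### Joint differential privacy of the auction -/

/-- The partial sums of the streams of a state. -/
def shift (st : State G n k) : P.Seed := nodeShift n P.rounds st.stream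

variable {P}

theorem noise_add_shift {ω : P.Seed} {st : State G n k} {c : Option (Fin k)} {τ : ℕ} (h0 : 0 < τ)
    (hτ : τ ≤ n * P.rounds) (hobs : c = none → Observed n P.rounds τ) :
    P.noise (ω + P.shift st) c τ = nodeSum (st.stream c) τ + P.noise ω c τ := by
  have h : τ - 1 < P.horizon := by unfold horizon; omega
  rw [noise, noise, dif_pos h, dif_pos h, Pi.add_apply, shift, nodeShift]
  have e : τ - 1 + 1 = τ := by omega
  have hno : ¬ (c = none ∧ ¬ Observed n P.rounds (τ - 1 + 1)) := fun h => h.2 (e ▸ hobs h.1)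
  rw [if_neg hno, e, add_comm]

/-- A reading uses only nodes at times in `1, …, n T`, and for the reports only observed ones;
exactly there the shift adds the partial sum of the stream. -/
theorem reader_eq {ω : P.Seed} {st : State G n k} {c : Option (Fin k)} {t : ℕ} {σ : ℕ → ℝ}
    (ht : IsReadingTime n P.rounds c t) (hσ : ∀ u ≤ t, σ u = st.stream c u) :
    P.noisyReader ω c σ t = P.nodeReader (ω + P.shift st) c σ t := by
  have htN : t ≤ n * P.rounds := by
    rcases ht with ⟨s, hs, rfl⟩ | h
    · have : (s + 1) * n ≤ P.rounds * n := Nat.mul_le_mul_right n hs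
      rw [Nat.add_mul] at this
      rw [Nat.mul_comm n]
      omega
    · exact h.2
  rw [noisyReader, binaryMechanism_eq_sumNodes, nodeReader]
  refine Finset.sum_congr rfl fun j hj => ?_
  have hj := (Finset.mem_filter.1 hj).2
  have hle : t / 2 ^ j * 2 ^ j ≤ t := Nat.div_mul_le_self _ _
  rw [noise_add_shift (node_pos hj) (hle.trans htN)]
  · change nodeSum σ _ + _ = _
    congr 1
    exact Finset.sum_congr rfl fun u hu => hσ u ((Finset.mem_Ioc.1 hu).2.trans hle)
  · rintro rfl
    rcases ht with ⟨s, hs, rfl⟩ | h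
    · exact ⟨s, hs, j, hj, rfl⟩
    · exact absurd rfl h.1

/-- The shift is computed from the final streams although the run is adaptive. This is consistent
because a reading uses only entries up to its own time, which never change later. -/
theorem runWith_nodeReader_add_shift (ω : P.Seed) :
    P.runWith choose v (P.nodeReader
        (ω + P.shift (P.runWith choose v (P.noisyReader ω) P.rounds))) P.rounds =
      P.runWith choose v (P.noisyReader ω) P.rounds :=
  runWith_congr (fun _ _ _ ht hσ => (reader_eq ht hσ).symm) le_rfl

theorem runWith_noisyReader_sub_shift (y : P.Seed) :
    P.runWith choose v (P.noisyReader
        (y - P.shift (P.runWith choose v (P.nodeReader y) P.rounds))) P.rounds =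
      P.runWith choose v (P.nodeReader y) P.rounds :=
  runWith_congr (fun _ _ _ ht hσ => by rw [reader_eq ht hσ, sub_add_cancel]) le_rfl

theorem measurable_shift (h : MeasurableState st) : Measurable fun ω => P.shift (st ω) := by
  refine measurable_pi_iff.2 fun q => ?_
  unfold shift nodeShift
  split_ifs
  · exact measurable_const
  · refine Finset.measurable_fun_sum _ fun u _ => ?_
    cases q.1 with
    | none => exact h.reports u
    | some j => exact h.bids j u

theorem BinaryStreams.stream_mem {st : State G n k} (h : BinaryStreams st) (c : Option (Fin k))
    (u : ℕ) : st.stream c u = 0 ∨ st.stream c u = 1 := by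
  cases c with
  | none => exact (h u).2
  | some j =>
    rcases (h u).1 with hb | ⟨l, hb⟩
    · exact Or.inl (congrFun hb j)
    · have := congrFun hb j
      change st.bids j u = _ at this
      change st.bids j u = 0 ∨ st.bids j u = 1
      rw [this, Pi.single_apply]
      split_ifs <;> simp

theorem BinaryStreams.shift_int {st : State G n k} (h : BinaryStreams st) :
    ∃ z : Option (Fin k) × Fin P.horizon → ℤ, ∀ q, P.shift st q = z q := by
  have key : ∀ q, P.shift st q ∈ (Int.castRingHom ℝ).range := by
    intro q
    unfold shift nodeShift
    split_ifs
    · exact zero_mem _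
    · refine sum_mem fun u _ => ?_
      rcases h.stream_mem q.1 u with h | h
      · rw [h]; exact zero_mem _
      · rw [h]; exact one_mem _
  choose z hz using key
  exact ⟨z, fun q => (hz q).symm⟩

theorem sum_abs_le_one_of_isBid {b : Fin k → ℝ} (h : IsBid b) : ∑ j, |b j| ≤ 1 := by
  rcases h with rfl | ⟨j, rfl⟩
  · simp
  · rw [Finset.sum_eq_single j (fun l _ hl => by simp [hl]) (by simp)]
    simp

theorem AgreeOff.sum_abs_shift_le {i : Fin n} {st st' : State G n k} (hT : 10 ≤ P.rounds)
    (h : AgreeOff P.rounds i st st') (hb : BinaryStreams st) (hb' : BinaryStreams st') :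
    ∑ q, |P.shift st q - P.shift st' q| ≤ 2 * P.rounds * levels P.horizon := by
  have e : ∀ q, P.shift st q - P.shift st' q =
      nodeShift n P.rounds (fun c u => st.stream c u - st'.stream c u) q := by
    intro q
    unfold shift nodeShift nodeSum
    split_ifs
    · simp
    · rw [Finset.sum_sub_distrib]
  simp only [e]
  refine sum_abs_nodeShift_le i.2 hT (fun c u hu => sub_eq_zero.2 ?_) (fun u => ?_) fun u => ?_
  · cases c with
    | none => exact h.reports u hu
    | some j => exact h.bids j u hu
  · calc ∑ j, |st.bids j u - st'.bids j u| ≤ ∑ j, (|st.bids j u| + |st'.bids j u|) :=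
          Finset.sum_le_sum fun j _ => abs_sub _ _
      _ ≤ 2 := by
          rw [Finset.sum_add_distrib]
          linarith [sum_abs_le_one_of_isBid (hb u).1, sum_abs_le_one_of_isBid (hb' u).1]
  · rcases hb.stream_mem none u with h | h <;> rcases hb'.stream_mem none u with h' | h' <;>
      rw [h, h'] <;> norm_num

theorem isJointDP_palloc (hε : 0 < P.ε) (hT : 10 ≤ P.rounds) :
    IsJointDP P.seedLaw (P.palloc choose) P.ε := by
  intro i D D' hD S
  have hT' : (0 : ℝ) < P.rounds := by exact_mod_cast (by omega : 0 < P.rounds)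
  have hε' : 0 < P.counterEps := by unfold counterEps; positivity
  have hL : (0 : ℝ) < levels P.horizon := by unfold levels; positivity
  let run : (Fin n → Valuation G P.type) → Reader k → State G n k := fun D rd =>
    P.runWith choose (fun i => (D i).val) rd P.rounds
  let out : State G n k → {j : Fin n // j ≠ i} → (Fin k → ℝ) × Finset G :=
    fun st j => (fun l => P.α * st.ticks l, st.held j)
  have hagree : ∀ y, AgreeOff P.rounds i (run D (P.nodeReader y)) (run D' (P.nodeReader y)) :=
    fun y => agreeOff_runWith (fun _ _ _ _ => rfl) (fun j hj => by simp only [hD j hj]) le_rfl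
  have hout : ∀ y, out (run D (P.nodeReader y)) = out (run D' (P.nodeReader y)) := by
    intro y
    funext j
    change (_, _) = (_, _)
    rw [(hagree y).ticks, (hagree y).held j j.2]
  have hmeas : ∀ D, MeasurableState fun y => run D (P.nodeReader y) := fun D =>
    measurableState_runWith P.measurableReader_nodeReader
  simp only [palloc_eq]
  -- The budget is met exactly: `2 T L / (L / ε') = 2 T ε' = ε`.
  refine measure_le_of_shift (b := levels P.horizon / P.counterEps)
    (c := 2 * P.rounds * levels P.horizon) (by positivity) (le_of_eq ?_)
    (out := fun ω => out (run D (P.noisyReader ω))) (out' := fun ω => out (run D' (P.noisyReader ω)))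
    (F := fun y => out (run D (P.nodeReader y)))
    (a := fun y => P.shift (run D (P.nodeReader y)))
    (a' := fun y => P.shift (run D' (P.nodeReader y)))
    (α := fun ω => P.shift (run D (P.noisyReader ω)))
    (α' := fun ω => P.shift (run D' (P.noisyReader ω)))
    (measurable_shift (hmeas D)) (measurable_shift (hmeas D'))
    (fun y => binaryStreams_runWith.shift_int) (fun y => binaryStreams_runWith.shift_int)
    (fun ω => congrArg P.shift (runWith_nodeReader_add_shift ω))
    (fun y => congrArg P.shift (runWith_noisyReader_sub_shift y))
    (fun ω => congrArg out (runWith_nodeReader_add_shift ω))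
    (fun y => (congrArg out (runWith_noisyReader_sub_shift y)).trans (hout y).symm)
    (fun y => (hagree y).sum_abs_shift_le hT binaryStreams_runWith binaryStreams_runWith) S ?_
  · unfold counterEps
    field_simp
  · exact measurableSet_pallocWith (P := P) (choose := choose) P.measurableReader_nodeReader D
      {f | (fun j : {j : Fin n // j ≠ i} => f j) ∈ S}

theorem ten_le_rounds (hα : 0 < P.α) (hα1 : P.α ≤ 1) (hρ : 0 < P.ρ) (hρ1 : P.ρ ≤ 1) :
    10 ≤ P.rounds := by
  have h : (10 : ℝ) ≤ 10 / (P.α * P.ρ) := by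
    rw [le_div_iff₀ (by positivity)]
    nlinarith
  exact_mod_cast h.trans (Nat.le_ceil _)

end Auction

end PrivateAuction

end

theorem mainTheorem5 {G : Type*} [Fintype G] [DecidableEq G] {n k : ℕ}
    (P : PrivateAuction.Auction G n k)
    (hα : 0 < P.α) (hα1 : P.α ≤ 1) (hρ : 0 < P.ρ) (hρ1 : P.ρ ≤ 1)
    (hε : 0 < P.ε) (hγ : 0 < P.γ) (hγ1 : P.γ < 1)
    (hs : ∀ j : Fin k, P.s ≤ (Finset.univ.filter fun g => P.type g = j).card)
    (choose : PrivateAuction.Choice G n k) (hchoose : P.IsChoiceRule choose) :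
    (∀ (D : Fin n → PrivateAuction.Valuation G P.type)
        (S : Set (Fin n → (Fin k → ℝ) × Finset G)),
      MeasurableSet {ω | P.palloc choose D ω ∈ S}) ∧
    PrivateAuction.IsJointDP P.seedLaw (P.palloc choose) P.ε := by
  refine ⟨fun D S => ?_, PrivateAuction.Auction.isJointDP_palloc hε
    (PrivateAuction.Auction.ten_le_rounds hα hα1 hρ hρ1)⟩
  simp only [PrivateAuction.Auction.palloc_eq]
  exact PrivateAuction.Auction.measurableSet_pallocWith P.measurableReader_noisyReader D S
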